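/- All Banach spaces are real. Let $X$ be a Banach space, $I$ a set and $\mathcal U$ an ultrafilter on $I$. The ultrapower $X^{\mathcal U}$ is the quotient of the space $\ell_\infty(X)$ of bounded families $(x_i)_{i\in I}$ in $X$ (with the supremum norm) by the closed subspace of those families with $\lim_{i,\mathcal U}\|x_i\|=0$. For $A\subset X$, $A^{\mathcal U}\subset X^{\mathcal U}$ denotes the set of classes of bounded families $(x_i)_{i\in I}$ with $x_i\in A$ for all $i\in I$; for a bounded operator $T:X\to Y$, $T^{\mathcal U}:X^{\mathcal U}\to Y^{\mathcal U}$ sends the class of $(x_i)_i$ to the class of $(Tx_i)_i$. A weakly closed set $A\subset X$ is super weakly compact (SWC) if $A^{\mathcal U}$ is relatively weakly compact in $X^{\mathcal U}$ for every free ultrafilter $\mathcal U$ on any infinite set $I$. A bounded operator is weakly compact if it maps the closed unit ball to a relatively weakly compact set, and $T$ is super weakly compact if $T^{\mathcal U}$ is weakly compact for every ultrafilter $\mathcal U$ on any set $I$. **Proposition.** Let $(\Omega,\Sigma,\mu)$ be an arbitrary measure space and let $K$ be a compact Hausdorff space. Then every weakly compact subset of $L^1(\Omega,\mu)$ and every weakly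 compact subset of $C(K)^*$ is SWC. Moreover, for every Banach space $X$, every weakly compact operator $T:X\to L^1(\Omega,\mu)$ and every weakly compact operator $T:C(K)\to X$ is super weakly compact. -/

import Mathlib

open Filter Topology Set MeasureTheory
open scoped ENNReal

universe w

/-- A set `S` in a real normed space is weakly compact: compact for the weak topology. -/
def IsWeaklyCompact {X : Type*} [NormedAddCommGroup X] [NormedSpace ℝ X] (S : Set X) : Prop :=
  IsCompact (toWeakSpace ℝ X '' S)

/-- A set `S` in a real normed space is weakly closed: closed for the weak topology. -/
def IsWeaklyClosed {X : Type*} [NormedAddCommGroup X] [NormedSpace ℝ X] (S : Set X) : Prop :=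
  IsClosed (toWeakSpace ℝ X '' S)

/-- A set `S` in a real normed space is relatively weakly compact: its closure for the weak
topology is weakly compact. -/
def IsRelativelyWeaklyCompact {X : Type*} [NormedAddCommGroup X] [NormedSpace ℝ X]
    (S : Set X) : Prop :=
  IsCompact (closure (toWeakSpace ℝ X '' S))

/-- A bounded operator is weakly compact if it maps the closed unit ball onto a relatively weakly
compact set. -/
def IsWeaklyCompactOperator {X Y : Type*} [NormedAddCommGroup X] [NormedSpace ℝ X]
    [NormedAddCommGroup Y] [NormedSpace ℝ Y] (T : X →L[ℝ] Y) : Prop :=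
  IsRelativelyWeaklyCompact (T '' Metric.closedBall 0 1)

/-- `ℓ_∞(X)`: bounded families in `X` indexed by `I`, with the supremum norm. -/
abbrev BddFamily (I : Type*) (X : Type*) [NormedAddCommGroup X] [NormedSpace ℝ X] : Type _ :=
  lp (fun _ : I => X) ∞

/-- The subspace of the bounded families `(x_i)` with `lim_{i, U} ‖x_i‖ = 0`. -/
def nullFamilies {I : Type*} (U : Ultrafilter I) (X : Type*) [NormedAddCommGroup X]
    [NormedSpace ℝ X] : Submodule ℝ (BddFamily I X) where
  carrier := {x | Tendsto (fun i => ‖x i‖) U (𝓝 0)}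
  zero_mem' := by simp
  add_mem' := by
    intro x y hx hy
    simp only [mem_ofPred_eq] at hx hy ⊢
    refine squeeze_zero (fun i => norm_nonneg _) (fun i => ?_) (by simpa using hx.add hy)
    simpa using norm_add_le (x i) (y i)
  smul_mem' := by
    intro c x hx
    simp only [mem_ofPred_eq] at hx ⊢
    simpa [norm_smul] using hx.const_mul ‖c‖

instance isClosed_nullFamilies {I : Type*} (U : Ultrafilter I) (X : Type*)
    [NormedAddCommGroup X] [NormedSpace ℝ X] :
    IsClosed (nullFamilies U X : Set (BddFamily I X)) := by
  rw [← isSeqClosed_iff_isClosed]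
  intro x a hx ha
  change Tendsto (fun i => ‖a i‖) U (𝓝 0)
  rw [Metric.tendsto_nhds]
  intro ε hε
  obtain ⟨n, hn⟩ := (Metric.tendsto_atTop.1 ha (ε / 2) (half_pos hε))
  have hxn : Tendsto (fun i => ‖x n i‖) U (𝓝 0) := hx n
  filter_upwards [Metric.tendsto_nhds.1 hxn (ε / 2) (half_pos hε)] with i hi
  have h1 : ‖(a - x n) i‖ ≤ ‖a - x n‖ := lp.norm_apply_le_norm ENNReal.top_ne_zero _ i
  have h2 : ‖a - x n‖ < ε / 2 := by
    rw [← dist_eq_norm, dist_comm]; exact hn n le_rfl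
  have h3 : ‖a i‖ ≤ ‖(a - x n) i‖ + ‖x n i‖ := by
    simpa using norm_add_le ((a - x n) i) (x n i)
  simp only [dist_zero_right, norm_norm] at hi ⊢
  linarith

/-- The ultrapower `X^U`: the quotient of `ℓ_∞(X)`, with its quotient norm, by the families whose
norms tend to `0` along `U`. -/
abbrev Ultrapower {I : Type*} (U : Ultrafilter I) (X : Type*) [NormedAddCommGroup X]
    [NormedSpace ℝ X] : Type _ :=
  BddFamily I X ⧸ nullFamilies U X

/-- `K^U`: the classes in `X^U` of the bounded families all of whose members lie in `K`. -/
def ultrapowerSet {I : Type*} (U : Ultrafilter I) {X : Type*} [NormedAddCommGroup X]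
    [NormedSpace ℝ X] (K : Set X) : Set (Ultrapower U X) :=
  (nullFamilies U X).mkQ '' {x | ∀ i, x i ∈ K}

/-- The operator `(x_i) ↦ (T x_i)` between the spaces of bounded families. -/
noncomputable def bddFamilyMap (I : Type*) {X Y : Type*} [NormedAddCommGroup X] [NormedSpace ℝ X]
    [NormedAddCommGroup Y] [NormedSpace ℝ Y] (T : X →L[ℝ] Y) :
    BddFamily I X →L[ℝ] BddFamily I Y :=
  LinearMap.mkContinuous
    { toFun := fun x => ⟨fun i => T (x i), memℓp_infty ⟨‖T‖ * ‖x‖, by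
        rintro _ ⟨i, rfl⟩
        exact T.le_opNorm_of_le (lp.norm_apply_le_norm ENNReal.top_ne_zero x i)⟩⟩
      map_add' := fun x y => by ext i; exact T.map_add (x i) (y i)
      map_smul' := fun c x => by ext i; exact T.map_smul c (x i) }
    ‖T‖ fun x => lp.norm_le_of_forall_le (by positivity) fun i =>
      T.le_opNorm_of_le (lp.norm_apply_le_norm ENNReal.top_ne_zero x i)

theorem bddFamilyMap_apply {I : Type*} {X Y : Type*} [NormedAddCommGroup X] [NormedSpace ℝ X]
    [NormedAddCommGroup Y] [NormedSpace ℝ Y] (T : X →L[ℝ] Y) (x : BddFamily I X) (i : I) :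
    bddFamilyMap I T x i = T (x i) := rfl

theorem nullFamilies_le_comap {I : Type*} (U : Ultrafilter I) {X Y : Type*}
    [NormedAddCommGroup X] [NormedSpace ℝ X] [NormedAddCommGroup Y] [NormedSpace ℝ Y]
    (T : X →L[ℝ] Y) :
    nullFamilies U X ≤ (nullFamilies U Y).comap (bddFamilyMap I T).toLinearMap := by
  intro x hx
  have hx' : Tendsto (fun i => ‖x i‖) U (𝓝 0) := hx
  change Tendsto (fun i => ‖T (x i)‖) U (𝓝 0)
  exact squeeze_zero (fun i => norm_nonneg _) (fun i => T.le_opNorm (x i))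
    (by simpa using hx'.const_mul ‖T‖)

/-- The operator `T^U : X^U → Y^U` sending the class of `(x_i)` to the class of `(T x_i)`. -/
noncomputable def ultrapowerMap {I : Type*} (U : Ultrafilter I) {X Y : Type*}
    [NormedAddCommGroup X] [NormedSpace ℝ X] [NormedAddCommGroup Y] [NormedSpace ℝ Y]
    (T : X →L[ℝ] Y) : Ultrapower U X →L[ℝ] Ultrapower U Y :=
  { toLinearMap := (nullFamilies U X).mapQ (nullFamilies U Y) (bddFamilyMap I T).toLinearMap
      (nullFamilies_le_comap U T)
    cont := continuous_quot_lift _ (continuous_quot_mk.comp (bddFamilyMap I T).continuous) }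

/-- `K` is super weakly compact: it is weakly closed, and `K^U` is relatively weakly compact in
`X^U` for every free ultrafilter `U` on any index set `I` (`U ≤ cofinite` says that `U` is free,
and forces `I` to be infinite). -/
def IsSuperWeaklyCompact {X : Type*} [NormedAddCommGroup X] [NormedSpace ℝ X]
    (K : Set X) : Prop :=
  IsWeaklyClosed K ∧ ∀ (I : Type w) (U : Ultrafilter I), (U : Filter I) ≤ cofinite →
    IsRelativelyWeaklyCompact (ultrapowerSet U K)

/-- The operator `T` is super weakly compact: `T^U` is weakly compact for every ultrafilter `U`. -/
def IsSuperWeaklyCompactOperator {X Y : Type*} [NormedAddCommGroup X] [NormedSpace ℝ X]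
    [NormedAddCommGroup Y] [NormedSpace ℝ Y] (T : X →L[ℝ] Y) : Prop :=
  ∀ (I : Type w) (U : Ultrafilter I), IsWeaklyCompactOperator (ultrapowerMap U T)

-- Everything reduces to Hilbert spaces, because the parallelogram law passes to ultrapowers and
-- balls of Hilbert spaces are weakly compact.
--
-- A relatively weakly compact set `S` in L¹ is almost order bounded: up to `ε` its members lie in
-- some `[-g, g]`, hence in the image of an L² ball under multiplication by `√g`. In `C(K)*` the
-- analogue is `|ν u| ≤ ∫ |u| dg + ε ‖u‖` for all `ν` in `S`. Cauchy–Schwarz replaces the integral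
-- by `‖j u‖` with `j : C(K) → L²(g)`, and Hahn–Banach turns the estimate into an `ε`-approximation
-- of `ν` by elements `j* h` with `‖h‖ ≤ 1`. An approximation by images of Hilbert balls survives in
-- the ultrapower, where Grothendieck's criterion (`isRelativelyWeaklyCompact_of_approx`) gives
-- relative weak compactness.
--
-- Both dominations are proved by contradiction. If they fail, a recursion with `G (n + 1) = 2 G n +
-- c |x n|` yields `x n` in `S` and almost disjoint test functions, hence functionals `q n` with `∑
-- |q n y| ≤ C ‖y‖` and `q n (x n) ≥ δ`. Rosenthal's lemma makes the off-diagonal terms small, and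
-- the tails of `∑ q n` then contradict weak compactness
-- (`IsRelativelyWeaklyCompact.not_forall_le_apply`).
--
-- Operators into L¹ follow from the result on sets. For `T` on `C(K)`, the adjoint is weakly
-- compact (Gantmacher), so domination gives `‖T u‖ ≤ ‖j u‖ + ε ‖u‖`. This inequality passes to
-- ultrapowers and implies weak compactness by Mazur's theorem.

universe v

/-! ### Weak compactness through ultrafilters -/

section WeakCompactness

variable {α E F : Type*} [NormedAddCommGroup E] [NormedSpace ℝ E]
  [NormedAddCommGroup F] [NormedSpace ℝ F]

/-- Weak convergence of a family in a real normed space along a filter. -/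
def TendstoWeakly (l : Filter α) (u : α → E) (x : E) : Prop :=
  ∀ f : StrongDual ℝ E, Tendsto (fun a => f (u a)) l (𝓝 (f x))

theorem tendstoWeakly_iff {l : Filter α} {u : α → E} {x : E} :
    TendstoWeakly l u x ↔ Tendsto (fun a => toWeakSpace ℝ E (u a)) l (𝓝 (toWeakSpace ℝ E x)) := by
  refine (WeakBilin.tendsto_iff_forall_eval_tendsto (topDualPairing ℝ E).flip ?_).symm
  intro x y h
  by_contra hne
  obtain ⟨f, hf⟩ := SeparatingDual.exists_separating_of_ne (R := ℝ) hne
  exact hf (DFunLike.congr_fun h f)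

theorem IsRelativelyWeaklyCompact.exists_tendstoWeakly {S : Set E}
    (hS : IsRelativelyWeaklyCompact S) (V : Ultrafilter α) {u : α → E}
    (hu : ∀ᶠ a in V, u a ∈ S) : ∃ x, TendstoWeakly (V : Filter α) u x := by
  obtain ⟨z, -, hz⟩ := isCompact_iff_ultrafilter_le_nhds.1 hS
    (V.map fun a => toWeakSpace ℝ E (u a)) (by
      rw [le_principal_iff]
      exact hu.mono fun a ha => subset_closure (mem_image_of_mem _ ha))
  refine ⟨(toWeakSpace ℝ E).symm z, tendstoWeakly_iff.2 ?_⟩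
  rw [LinearEquiv.apply_symm_apply]
  exact hz

/-- Regularity makes it enough to test ultrafilters living on `A` itself. An ultrafilter `W` on the
closure is traced by its open members onto `A`, and a limit of the trace is a limit of `W`, since
closed neighbourhoods form a basis. -/
theorem isCompact_closure_of_ultrafilter {Z : Type*} [TopologicalSpace Z] [RegularSpace Z]
    {A : Set Z} (h : ∀ V : Ultrafilter Z, A ∈ V → ∃ z, (V : Filter Z) ≤ 𝓝 z) :
    IsCompact (closure A) := by
  rw [isCompact_iff_ultrafilter_le_nhds]
  intro W hW
  rw [le_principal_iff] at hW
  let G : Filter Z := ⨅ O : {O : Set Z // IsOpen O ∧ O ∈ W}, 𝓟 (O.1 ∩ A)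
  have : Nonempty {O : Set Z // IsOpen O ∧ O ∈ W} := ⟨⟨univ, isOpen_univ, univ_mem⟩⟩
  have hG : G.NeBot := by
    refine iInf_neBot_of_directed' ?_ ?_
    · rintro ⟨O, hO, hOW⟩ ⟨P, hP, hPW⟩
      refine ⟨⟨O ∩ P, hO.inter hP, inter_mem hOW hPW⟩, ?_, ?_⟩ <;>
      · simp only [ge_iff_le, le_principal_iff, mem_principal]
        tauto_set
    · rintro ⟨O, hO, hOW⟩
      rw [principal_neBot_iff]
      obtain ⟨x, hx, hx'⟩ := W.nonempty_of_mem (inter_mem hOW hW)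
      exact mem_closure_iff.1 hx' O hO hx
  let V := Ultrafilter.of G
  have hV : ∀ O : Set Z, IsOpen O → O ∈ W → O ∩ A ∈ V := fun O hO hOW =>
    Ultrafilter.of_le _ (mem_iInf_of_mem (⟨O, hO, hOW⟩ : {O : Set Z // IsOpen O ∧ O ∈ W})
      (mem_principal_self _))
  obtain ⟨z, hz⟩ := h V (mem_of_superset (hV univ isOpen_univ univ_mem) inter_subset_right)
  have hWz : (W : Filter Z) ≤ 𝓝 z := by
    intro N hN
    obtain ⟨C, hC, hCc, hCN⟩ := exists_mem_nhds_isClosed_subset hN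
    by_contra hNW
    have h1 : Cᶜ ∈ W := Ultrafilter.compl_mem_iff_notMem.2 fun h => hNW (mem_of_superset h hCN)
    have h2 := hV _ hCc.isOpen_compl h1
    have h3 : C ∩ (Cᶜ ∩ A) ∈ V := inter_mem (hz hC) h2
    obtain ⟨x, hx⟩ := V.nonempty_of_mem h3
    exact hx.2.1 hx.1
  exact ⟨z, isClosed_closure.mem_of_tendsto (f := id) (b := (W : Filter Z)) hWz hW, hWz⟩

theorem isRelativelyWeaklyCompact_image {A : Set α} {u : α → E}
    (h : ∀ W : Ultrafilter α, A ∈ W → ∃ z, TendstoWeakly (W : Filter α) u z) :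
    IsRelativelyWeaklyCompact (u '' A) := by
  refine isCompact_closure_of_ultrafilter fun V hV => ?_
  rw [image_image] at hV
  let W := Ultrafilter.ofComapInfPrincipal hV
  obtain ⟨z, hz⟩ := h W (Ultrafilter.ofComapInfPrincipal_mem hV)
  refine ⟨toWeakSpace ℝ E z, ?_⟩
  rw [← Ultrafilter.ofComapInfPrincipal_eq_of_map hV]
  exact tendstoWeakly_iff.1 hz

theorem IsRelativelyWeaklyCompact.mono {S S' : Set E} (hS : IsRelativelyWeaklyCompact S)
    (h : S' ⊆ S) : IsRelativelyWeaklyCompact S' :=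
  IsCompact.of_isClosed_subset hS isClosed_closure (closure_mono (image_mono h))

theorem TendstoWeakly.map {l : Filter α} {u : α → E} {x : E} (h : TendstoWeakly l u x)
    (T : E →L[ℝ] F) : TendstoWeakly l (fun a => T (u a)) (T x) :=
  fun f => h (f.comp T)

theorem IsRelativelyWeaklyCompact.image {S : Set E} (hS : IsRelativelyWeaklyCompact S)
    (T : E →L[ℝ] F) : IsRelativelyWeaklyCompact (T '' S) :=
  isRelativelyWeaklyCompact_image fun W hW =>
    let ⟨x, hx⟩ := hS.exists_tendstoWeakly W (u := id) hW
    ⟨T x, hx.map T⟩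

theorem IsWeaklyCompact.isWeaklyClosed {S : Set E} (hS : IsWeaklyCompact S) :
    IsWeaklyClosed S :=
  IsCompact.isClosed hS

theorem IsWeaklyCompact.isRelativelyWeaklyCompact {S : Set E} (hS : IsWeaklyCompact S) :
    IsRelativelyWeaklyCompact S := by
  have := hS.isWeaklyClosed.closure_eq
  rw [IsRelativelyWeaklyCompact, this]
  exact hS

theorem IsRelativelyWeaklyCompact.exists_norm_le {S : Set E}
    (hS : IsRelativelyWeaklyCompact S) : ∃ M, ∀ x ∈ S, ‖x‖ ≤ M := by
  have h : ∀ f : StrongDual ℝ E, ∃ C, ∀ x : S, ‖NormedSpace.inclusionInDoubleDual ℝ E x f‖ ≤ C := by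
    intro f
    have hc : Continuous fun z : WeakSpace ℝ E => f ((toWeakSpace ℝ E).symm z) :=
      WeakBilin.eval_continuous (topDualPairing ℝ E).flip f
    obtain ⟨C, hC⟩ := (IsCompact.exists_bound_of_continuousOn hS hc.continuousOn)
    exact ⟨C, fun x => hC _ (subset_closure (mem_image_of_mem _ x.2))⟩
  obtain ⟨C, hC⟩ := banach_steinhaus h
  refine ⟨C, fun x hx => ?_⟩
  rw [← (NormedSpace.inclusionInDoubleDualLi (E := E) ℝ).norm_map x]
  exact hC ⟨x, hx⟩

/-- The limit of `u` in the bidual is within `ε` of `E` for every `ε`, and `E` is norm closed in its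
bidual by completeness. The point `z` must not depend on `f`, but the set of the ultrafilter may. -/
theorem exists_tendstoWeakly_of_approx [CompleteSpace E] {V : Ultrafilter α} {u : α → E}
    (h : ∀ ε > 0, ∃ z, ∀ f : StrongDual ℝ E, ‖f‖ ≤ 1 → ∀ᶠ a in V, |f (u a) - f z| ≤ ε) :
    ∃ z, TendstoWeakly (V : Filter α) u z := by
  choose! z hz using h
  have hpos : ∀ n : ℕ, (0 : ℝ) < 1 / (n + 1) := fun n => Nat.one_div_pos_of_nat
  have hd : ∀ ε > 0, ∀ δ > 0, ‖z ε - z δ‖ ≤ ε + δ := by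
    intro ε hε δ hδ
    obtain ⟨f, hf, hfz⟩ := exists_dual_vector'' ℝ (z ε - z δ)
    obtain ⟨a, h1, h2⟩ := ((hz ε hε f hf).and (hz δ hδ f hf)).exists
    simp only [map_sub, RCLike.ofReal_real_eq_id, id_eq] at hfz
    rw [← hfz]
    rw [abs_le] at h1 h2
    linarith
  have hcau : CauchySeq fun n : ℕ => z (1 / ((n : ℝ) + 1)) := by
    refine cauchySeq_of_le_tendsto_0 (fun n : ℕ => 1 / ((n : ℝ) + 1) + 1 / ((n : ℝ) + 1)) ?_ ?_
    · intro n m N hn hm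
      rw [dist_eq_norm]
      exact (hd _ (hpos n) _ (hpos m)).trans
        (add_le_add (Nat.one_div_le_one_div hn) (Nat.one_div_le_one_div hm))
    · simpa using (tendsto_one_div_add_atTop_nhds_zero_nat (𝕜 := ℝ)).add
        tendsto_one_div_add_atTop_nhds_zero_nat
  obtain ⟨y, hy⟩ := cauchySeq_tendsto_of_complete hcau
  have key : ∀ f : StrongDual ℝ E, ‖f‖ ≤ 1 → Tendsto (fun a => f (u a)) V (𝓝 (f y)) := by
    intro f hf
    rw [Metric.tendsto_nhds]
    intro ε hε
    have h1 := (tendsto_one_div_add_atTop_nhds_zero_nat (𝕜 := ℝ)).eventually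
      (gt_mem_nhds (half_pos hε))
    have h2 := Metric.tendsto_nhds.1 ((f.continuous.tendsto y).comp hy) (ε / 2) (half_pos hε)
    obtain ⟨n, h1, h2⟩ := (h1.and h2).exists
    filter_upwards [hz _ (hpos n) f hf] with a ha
    rw [Function.comp_apply, Real.dist_eq] at h2
    rw [Real.dist_eq]
    calc _ ≤ _ := abs_sub_le _ (f (z (1 / ((n : ℝ) + 1)))) _
      _ < ε := by linarith
  refine ⟨y, fun f => ?_⟩
  have hfpos : 0 < ‖f‖ + 1 := by positivity
  have := (key ((‖f‖ + 1)⁻¹ • f) (by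
    rw [norm_smul, norm_inv, Real.norm_of_nonneg hfpos.le, inv_mul_le_iff₀ hfpos]
    linarith)).const_mul (‖f‖ + 1)
  simpa [mul_inv_cancel_left₀ hfpos.ne'] using this

/-- Grothendieck's criterion: the weak limit of the approximants `k x` in `K` approximates the
bidual limit of the points `x`. -/
theorem isRelativelyWeaklyCompact_of_approx [CompleteSpace E] {S : Set E}
    (h : ∀ ε > 0, ∃ K : Set E, IsRelativelyWeaklyCompact K ∧ ∀ x ∈ S, ∃ k ∈ K, ‖x - k‖ ≤ ε) :
    IsRelativelyWeaklyCompact S := by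
  rw [← image_id S]
  refine isRelativelyWeaklyCompact_image fun V hV => exists_tendstoWeakly_of_approx fun ε hε => ?_
  obtain ⟨K, hK, hSK⟩ := h (ε / 2) (half_pos hε)
  choose! k hk hxk using hSK
  obtain ⟨z, hz⟩ := hK.exists_tendstoWeakly V (u := k) (mem_of_superset hV hk)
  refine ⟨z, fun f hf => ?_⟩
  filter_upwards [hV, Metric.tendsto_nhds.1 (hz f) (ε / 2) (half_pos hε)] with x hx h2
  rw [Real.dist_eq] at h2
  have h3 : |f x - f (k x)| ≤ ε / 2 := by
    rw [← map_sub, ← Real.norm_eq_abs]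
    exact (f.le_of_opNorm_le hf _).trans (by simpa using hxk x hx)
  calc _ ≤ _ := abs_sub_le _ (f (k x)) _
    _ ≤ ε := by simp only [id]; linarith

theorem TendstoWeakly.mem_closure_convexHull {V : Filter α} [V.NeBot] {u : α → E} {x : E}
    (h : TendstoWeakly V u x) {A : Set α} (hA : A ∈ V) :
    x ∈ closure (convexHull ℝ (u '' A)) := by
  by_contra hx
  obtain ⟨f, c, h1, h2⟩ := geometric_hahn_banach_point_closed
    (convex_convexHull ℝ (u '' A)).closure isClosed_closure hx
  refine absurd (ge_of_tendsto (h f) (b := c) ?_) (not_le.2 h1)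
  filter_upwards [hA] with a ha
  exact (h2 _ (subset_closure (subset_convexHull ℝ _ (mem_image_of_mem _ ha)))).le

theorem exists_tendsto_of_bounded (V : Ultrafilter α) {u : α → ℝ} {C : ℝ}
    (h : ∀ᶠ a in V, |u a| ≤ C) : ∃ c, Tendsto u V (𝓝 c) := by
  obtain ⟨c, -, hc⟩ := isCompact_iff_ultrafilter_le_nhds.1 (isCompact_Icc (a := -C) (b := C))
    (V.map u) (by
      rw [le_principal_iff]
      exact h.mono fun a ha => abs_le.1 ha)
  exact ⟨c, hc⟩

/-- Bounded families of functionals converge pointwise along ultrafilters. -/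
theorem exists_weakStar_limit (V : Ultrafilter α) {u : α → StrongDual ℝ E} {C : ℝ}
    (h : ∀ᶠ a in V, ‖u a‖ ≤ C) :
    ∃ f : StrongDual ℝ E, ‖f‖ ≤ C ∧ ∀ x, Tendsto (fun a => u a x) V (𝓝 (f x)) := by
  have hle : ∀ x, ∀ᶠ a in V, |u a x| ≤ C * ‖x‖ := fun x => h.mono fun a ha =>
    (u a).le_of_opNorm_le ha x
  have hC : 0 ≤ C := let ⟨a, ha⟩ := h.exists; (norm_nonneg _).trans ha
  choose f hf using fun x => exists_tendsto_of_bounded V (hle x)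
  let g : E →ₗ[ℝ] ℝ :=
    { toFun := f
      map_add' := fun x y => tendsto_nhds_unique (hf (x + y)) (by simpa using (hf x).add (hf y))
      map_smul' := fun c x => tendsto_nhds_unique (hf (c • x)) (by simpa using (hf x).const_mul c) }
  have hg : ∀ x, ‖g x‖ ≤ C * ‖x‖ := fun x => le_of_tendsto (hf x).abs (hle x)
  exact ⟨g.mkContinuous C hg, g.mkContinuous_norm_le hC hg, hf⟩

theorem exists_bidual_limit (V : Ultrafilter α) {x : α → E} {C : ℝ} (h : ∀ᶠ a in V, ‖x a‖ ≤ C) :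
    ∃ Φ : StrongDual ℝ (StrongDual ℝ E), ∀ f : StrongDual ℝ E,
      Tendsto (fun a => f (x a)) V (𝓝 (Φ f)) :=
  let ⟨Φ, _, hΦ⟩ := exists_weakStar_limit V
    (u := fun a => NormedSpace.inclusionInDoubleDual ℝ E (x a))
    (h.mono fun a ha => (NormedSpace.double_dual_bound ℝ E (x a)).trans ha)
  ⟨Φ, hΦ⟩

theorem isRelativelyWeaklyCompact_closedBall [CompleteSpace E] [InnerProductSpaceable E] (r : ℝ) :
    IsRelativelyWeaklyCompact (Metric.closedBall (0 : E) r) := by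
  let _ : InnerProductSpace ℝ E :=
    InnerProductSpace.ofNorm ℝ InnerProductSpaceable.parallelogram_identity
  rw [← image_id (Metric.closedBall (0 : E) r)]
  refine isRelativelyWeaklyCompact_image fun W hW => ?_
  obtain ⟨f, -, hf⟩ := exists_weakStar_limit W (u := fun x : E => InnerProductSpace.toDual ℝ E x)
    (C := r) (mem_of_superset hW fun x hx => by simpa using hx)
  refine ⟨(InnerProductSpace.toDual ℝ E).symm f, fun g => ?_⟩
  obtain ⟨y, rfl⟩ := (InnerProductSpace.toDual ℝ E).surjective g
  have := hf y
  simp only [InnerProductSpace.toDual_apply_apply, id] at this ⊢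
  rw [real_inner_comm, InnerProductSpace.toDual_symm_apply]
  simpa only [real_inner_comm y] using this

/-- Along an ultrafilter on the unit ball, `j x` converges weakly to some `y`. By Mazur, convex
combinations of points `x` have images norm close to `y`, so the hypothesis makes their images under
`T` close to each other. One of them is the approximate limit `T x₀`. -/
theorem isWeaklyCompactOperator_of_norm_le [CompleteSpace F] {T : E →L[ℝ] F}
    (h : ∀ ε > 0, ∃ (H : Type v) (_ : NormedAddCommGroup H) (_ : NormedSpace ℝ H)
      (_ : CompleteSpace H) (_ : InnerProductSpaceable H) (j : E →L[ℝ] H),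
      ∀ x, ‖T x‖ ≤ ‖j x‖ + ε * ‖x‖) :
    IsWeaklyCompactOperator T := by
  refine isRelativelyWeaklyCompact_image fun W hW => exists_tendstoWeakly_of_approx fun ε hε => ?_
  obtain ⟨H, _, _, _, _, j, hj⟩ := h (ε / 8) (by positivity)
  obtain ⟨y, hy⟩ := (isRelativelyWeaklyCompact_closedBall (E := H) ‖j‖).exists_tendstoWeakly W
    (u := j) (mem_of_superset hW fun x hx => by
      simpa using j.le_of_opNorm_le_of_le le_rfl (mem_closedBall_zero_iff.1 hx))
  have hmazur : ∀ A ∈ W, A ⊆ Metric.closedBall (0 : E) 1 →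
      ∃ x ∈ convexHull ℝ A, ‖x‖ ≤ 1 ∧ ‖j x - y‖ ≤ ε / 8 := by
    intro A hA hAB
    obtain ⟨_, hz, hd⟩ := Metric.mem_closure_iff.1 (hy.mem_closure_convexHull hA) (ε / 8)
      (by positivity)
    rw [← j.coe_coe, ← LinearMap.image_convexHull] at hz
    obtain ⟨x, hx, rfl⟩ := hz
    refine ⟨x, hx, mem_closedBall_zero_iff.1 (convexHull_min hAB (convex_closedBall _ _) hx), ?_⟩
    rw [← dist_eq_norm, dist_comm]
    exact hd.le
  obtain ⟨x₀, -, hx₀, hjx₀⟩ := hmazur _ hW subset_rfl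
  refine ⟨T x₀, fun f hf => ?_⟩
  obtain ⟨c, hc⟩ := exists_tendsto_of_bounded W (u := fun x => f (T x)) (C := ‖T‖)
    (mem_of_superset hW fun x hx => by
      refine (f.le_of_opNorm_le hf _).trans ?_
      simpa using T.le_of_opNorm_le_of_le le_rfl (mem_closedBall_zero_iff.1 hx))
  have hA := inter_mem hW (Metric.tendsto_nhds.1 hc (ε / 8) (by positivity))
  -- While `x₀` is fixed before `f`, `x₁` depends on `f`: it is a convex combination of points where
  -- `f ∘ T` is near its limit `c`, so `f (T x₁)` is near `c` too.
  obtain ⟨x₁, hx₁A, hx₁, hjx₁⟩ := hmazur _ hA inter_subset_left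
  have hcx : dist (f (T x₁)) c < ε / 8 := by
    have hconv : Convex ℝ ((f.comp T : E →ₗ[ℝ] ℝ) ⁻¹' Metric.ball c (ε / 8)) :=
      (convex_ball _ _).linear_preimage _
    exact convexHull_min inter_subset_right hconv hx₁A
  have hjd : ‖j (x₁ - x₀)‖ ≤ ε / 8 + ε / 8 := by
    rw [map_sub, ← sub_sub_sub_cancel_right _ _ y]
    exact (norm_sub_le _ _).trans (add_le_add hjx₁ hjx₀)
  have hxd : ‖x₁ - x₀‖ ≤ 1 + 1 := (norm_sub_le _ _).trans (add_le_add hx₁ hx₀)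
  have hfd : |f (T x₁) - f (T x₀)| ≤ ε / 2 := by
    rw [← map_sub, ← map_sub, ← Real.norm_eq_abs]
    refine (f.le_of_opNorm_le hf _).trans ?_
    have h8 : ε / 8 * ‖x₁ - x₀‖ ≤ ε / 8 * (1 + 1) := by gcongr
    linarith [hj (x₁ - x₀)]
  filter_upwards [hA] with x hx
  have hx2 : dist (f (T x)) c < ε / 8 := hx.2
  rw [Real.dist_eq, abs_lt] at hx2 hcx
  rw [abs_le] at hfd ⊢
  constructor <;> linarith

/-- The second adjoint of a weakly compact operator takes its values in the range space. -/
theorem IsWeaklyCompactOperator.exists_bidual_apply {T : E →L[ℝ] F}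
    (hT : IsWeaklyCompactOperator T) {Φ : StrongDual ℝ (StrongDual ℝ E)} (hΦ : ‖Φ‖ ≤ 1) :
    ∃ z, ∀ f : StrongDual ℝ F, Φ (f.comp T) = f z := by
  let C := closure (toWeakSpace ℝ F '' (T '' Metric.closedBall 0 1))
  let D : StrongDual ℝ F → Set (WeakSpace ℝ F) := fun f =>
    {z | f ((toWeakSpace ℝ F).symm z) = Φ (f.comp T)}
  have hcont : ∀ f : StrongDual ℝ F, Continuous fun z : WeakSpace ℝ F =>
      f ((toWeakSpace ℝ F).symm z) :=
    fun f => WeakBilin.eval_continuous (topDualPairing ℝ F).flip f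
  have hD : ∀ f, IsClosed (D f) := fun f => isClosed_eq (hcont f) continuous_const
  -- By compactness, finitely many equations at a time suffice. If they have no solution in `C`,
  -- separation in `ℝ^s` gives one combination `b` of the functionals with `‖b ∘ T‖ ≤ c < Φ (b ∘
  -- T)`, against `‖Φ‖ ≤ 1`.
  obtain ⟨z, -, hz⟩ := hT.inter_iInter_nonempty D hD (by
    classical
    intro s
    let ev : WeakSpace ℝ F →ₗ[ℝ] (s → ℝ) :=
      LinearMap.pi fun f => (f.1 : F →ₗ[ℝ] ℝ) ∘ₗ (toWeakSpace ℝ F).symm.toLinearMap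
    have hev : Continuous ev := continuous_pi fun f => hcont f.1
    by_contra hne
    have hnot : (fun f : s => Φ (f.1.comp T)) ∉ ev '' C := by
      rintro ⟨z, hzC, hz⟩
      exact hne ⟨z, hzC, mem_iInter₂.2 fun f hf => congrFun hz ⟨f, hf⟩⟩
    have hconv : Convex ℝ (ev '' C) := by
      refine Convex.linear_image (Convex.closure ?_) ev
      exact ((convex_closedBall _ _).linear_image T.toLinearMap).linear_image
        (toWeakSpace ℝ F).toLinearMap
    obtain ⟨g, c, hgc, hcg⟩ := geometric_hahn_banach_closed_point hconv
      (IsCompact.image (s := C) hT hev).isClosed hnot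
    let b : StrongDual ℝ F := ∑ f : s, g (Pi.single f 1) • f.1
    have hg : ∀ v : s → ℝ, g v = ∑ f : s, g (Pi.single f 1) * v f := by
      intro v
      conv_lhs => rw [pi_eq_sum_univ' v]
      simp [map_sum, mul_comm]
    have hΦb : Φ (b.comp T) = g fun f : s => Φ (f.1.comp T) := by
      have : b.comp T = ∑ f : s, g (Pi.single f 1) • f.1.comp T := by
        ext x
        simp [b]
      rw [this, hg, map_sum]
      simp only [map_smul, smul_eq_mul]
    have hb : ‖b.comp T‖ ≤ c := by
      have hlt : ∀ x : E, ‖x‖ ≤ 1 → b (T x) < c := by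
        intro x hx
        have := hgc _ (mem_image_of_mem ev (subset_closure (mem_image_of_mem _
          (mem_image_of_mem T (mem_closedBall_zero_iff.2 hx)))))
        rw [hg] at this
        simpa [b, ev] using this
      have hc0 : 0 ≤ c := by simpa using (hlt 0 (by simp)).le
      refine ContinuousLinearMap.opNorm_le_of_unit_norm hc0 fun x hx => ?_
      rw [Real.norm_eq_abs, abs_le]
      have h1 := hlt x hx.le
      have h2 := hlt (-x) (by simpa using hx.le)
      simp only [map_neg] at h2
      exact ⟨by simp only [ContinuousLinearMap.comp_apply]; linarith, h1.le⟩
    have h1 := Φ.le_of_opNorm_le hΦ (b.comp T)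
    rw [hΦb, Real.norm_eq_abs] at h1
    linarith [le_abs_self (g fun f : s => Φ (f.1.comp T))])
  exact ⟨(toWeakSpace ℝ F).symm z, fun f => (mem_iInter.1 hz f).symm⟩

/-- The adjoint of a weakly compact operator is weakly compact. -/
theorem IsWeaklyCompactOperator.isRelativelyWeaklyCompact_adjoint {T : E →L[ℝ] F}
    (hT : IsWeaklyCompactOperator T) :
    IsRelativelyWeaklyCompact
      ((fun f : StrongDual ℝ F => f.comp T) '' Metric.closedBall 0 1) := by
  refine isRelativelyWeaklyCompact_image fun W hW => ?_
  obtain ⟨f₀, -, hf₀⟩ := exists_weakStar_limit W (u := id) (C := 1)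
    (mem_of_superset hW fun f hf => mem_closedBall_zero_iff.1 hf)
  refine ⟨f₀.comp T, fun Φ => ?_⟩
  have hpos : 0 < ‖Φ‖ + 1 := by positivity
  obtain ⟨z, hz⟩ := hT.exists_bidual_apply (Φ := (‖Φ‖ + 1)⁻¹ • Φ) (by
    refine (Φ.opNorm_smul_le _).trans ?_
    rw [norm_inv, Real.norm_of_nonneg hpos.le, inv_mul_le_iff₀ hpos]
    linarith)
  have hz' : ∀ f : StrongDual ℝ F, Φ (f.comp T) = (‖Φ‖ + 1) * f z := fun f => by
    rw [← hz, smul_apply, smul_eq_mul, mul_inv_cancel_left₀ hpos.ne']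
  simp only [hz']
  exact (hf₀ z).const_mul _

end WeakCompactness

/-! ### Norms, Hilbert structure and approximation in ultrapowers -/

section Ultrapower

variable {I : Type*} (U : Ultrafilter I) {E F : Type*} [NormedAddCommGroup E] [NormedSpace ℝ E]
  [NormedAddCommGroup F] [NormedSpace ℝ F]

/-- The norm of a class in the ultrapower is the limit of the norms of its members. -/
theorem tendsto_norm_ultrapower (x : BddFamily I E) :
    Tendsto (fun i => ‖x i‖) U (𝓝 ‖(nullFamilies U E).mkQ x‖) := by
  classical
  obtain ⟨L, hL⟩ := exists_tendsto_of_bounded U (u := fun i => ‖x i‖) (C := ‖x‖)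
    (Eventually.of_forall fun i => by
      rw [abs_norm]
      exact lp.norm_apply_le_norm ENNReal.top_ne_zero x i)
  have hL0 : 0 ≤ L := ge_of_tendsto' hL fun i => norm_nonneg _
  suffices h : ‖(nullFamilies U E).mkQ x‖ = L by rwa [h]
  refine le_antisymm (le_of_forall_pos_le_add fun δ hδ => ?_)
    (le_of_forall_pos_le_add fun δ hδ => ?_)
  · have hev : ∀ᶠ i in U, ‖x i‖ ≤ L + δ := hL.eventually (ge_mem_nhds (by linarith))
    -- Zeroing the coordinates of norm above `L + δ` does not change the class and brings the
    -- supremum norm down to `L + δ`.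
    let y : BddFamily I E := ⟨fun i => if ‖x i‖ ≤ L + δ then x i else 0,
      memℓp_infty ⟨L + δ, by
        rintro _ ⟨i, rfl⟩
        dsimp only
        split_ifs with h
        · exact h
        · simpa using by positivity⟩⟩
    have hy : ∀ i, y i = if ‖x i‖ ≤ L + δ then x i else 0 := fun i => rfl
    have hxy : (nullFamilies U E).mkQ x = (nullFamilies U E).mkQ y := by
      refine (Submodule.Quotient.eq _).2 ?_
      change Tendsto (fun i => ‖(x - y) i‖) U (𝓝 0)
      refine tendsto_const_nhds.congr' ?_
      filter_upwards [hev] with i hi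
      simp [hy, hi]
    rw [hxy]
    refine (Submodule.Quotient.norm_mk_le _ y).trans
      (lp.norm_le_of_forall_le (by positivity) fun i => ?_)
    rw [hy]
    split_ifs with h
    · exact h
    · simpa using by positivity
  · obtain ⟨y, hy, hyn⟩ := Submodule.Quotient.norm_mk_lt ((nullFamilies U E).mkQ x) hδ
    have hnull : Tendsto (fun i => ‖(x - y) i‖) U (𝓝 0) :=
      (Submodule.Quotient.eq _).1 hy.symm
    have hlim : Tendsto (fun i => ‖x i‖ - ‖(x - y) i‖) U (𝓝 L) := by simpa using hL.sub hnull
    refine le_trans (le_of_tendsto' hlim fun i => ?_) hyn.le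
    have h1 : ‖x i‖ ≤ ‖(x - y) i‖ + ‖y i‖ := by
      simpa using norm_add_le ((x - y) i) (y i)
    linarith [lp.norm_apply_le_norm ENNReal.top_ne_zero y i]

theorem exists_ultrapower_rep (ξ : Ultrapower U E) {r : ℝ} (h : ‖ξ‖ < r) :
    ∃ x : BddFamily I E, (nullFamilies U E).mkQ x = ξ ∧ ∀ i, ‖x i‖ ≤ r := by
  obtain ⟨x, hx, hxn⟩ := Submodule.Quotient.norm_mk_lt ξ (sub_pos.2 h)
  refine ⟨x, hx, fun i => (lp.norm_apply_le_norm ENNReal.top_ne_zero x i).trans ?_⟩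
  linarith

theorem ultrapowerMap_mk (T : E →L[ℝ] F) (x : BddFamily I E) :
    ultrapowerMap U T ((nullFamilies U E).mkQ x) = (nullFamilies U F).mkQ (bddFamilyMap I T x) :=
  rfl

/-- The parallelogram law is an identity between norms, and norms in the ultrapower are limits of
norms. Stating it as a property of the norm avoids choosing an inner product on the quotient. -/
instance innerProductSpaceable_ultrapower [InnerProductSpaceable E] :
    InnerProductSpaceable (Ultrapower U E) := by
  refine ⟨fun ξ η => ?_⟩
  obtain ⟨x, rfl⟩ := (nullFamilies U E).mkQ_surjective ξ
  obtain ⟨y, rfl⟩ := (nullFamilies U E).mkQ_surjective η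
  rw [← map_add, ← map_sub]
  have h := fun z => tendsto_norm_ultrapower U (E := E) z
  refine tendsto_nhds_unique (((h (x + y)).mul (h (x + y))).add ((h (x - y)).mul (h (x - y)))) ?_
  refine ((((h x).mul (h x)).add ((h y).mul (h y))).const_mul 2).congr fun i => ?_
  simp [InnerProductSpaceable.parallelogram_identity (x i) (y i)]

/-- A set that is norm-approximable by images of Hilbert balls has relatively weakly compact
ultrapowers. -/
theorem isRelativelyWeaklyCompact_ultrapowerSet [CompleteSpace E] {S : Set E}
    (h : ∀ ε > 0, ∃ (H : Type v) (_ : NormedAddCommGroup H) (_ : NormedSpace ℝ H)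
      (_ : CompleteSpace H) (_ : InnerProductSpaceable H) (R : H →L[ℝ] E) (r : ℝ),
      ∀ x ∈ S, ∃ y : H, ‖y‖ ≤ r ∧ ‖x - R y‖ ≤ ε) :
    IsRelativelyWeaklyCompact (ultrapowerSet U S) := by
  refine isRelativelyWeaklyCompact_of_approx fun ε hε => ?_
  obtain ⟨H, _, _, _, _, R, r, hR⟩ := h ε hε
  refine ⟨ultrapowerMap U R '' Metric.closedBall 0 r,
    (isRelativelyWeaklyCompact_closedBall r).image _, ?_⟩
  rintro _ ⟨x, hx, rfl⟩
  choose y hy hxy using fun i => hR (x i) (hx i)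
  let z : BddFamily I H := ⟨y, memℓp_infty ⟨r, by rintro _ ⟨i, rfl⟩; exact hy i⟩⟩
  refine ⟨ultrapowerMap U R ((nullFamilies U H).mkQ z), mem_image_of_mem _ ?_, ?_⟩
  · exact mem_closedBall_zero_iff.2 (le_of_tendsto' (tendsto_norm_ultrapower U z) hy)
  · rw [ultrapowerMap_mk, ← map_sub]
    exact le_of_tendsto' (tendsto_norm_ultrapower U _) hxy

theorem norm_ultrapowerMap_le {H : Type*} [NormedAddCommGroup H] [NormedSpace ℝ H]
    {T : E →L[ℝ] F} {j : E →L[ℝ] H} {ε : ℝ} (h : ∀ x, ‖T x‖ ≤ ‖j x‖ + ε * ‖x‖)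
    (ξ : Ultrapower U E) :
    ‖ultrapowerMap U T ξ‖ ≤ ‖ultrapowerMap U j ξ‖ + ε * ‖ξ‖ := by
  obtain ⟨x, rfl⟩ := (nullFamilies U E).mkQ_surjective ξ
  exact le_of_tendsto_of_tendsto' (tendsto_norm_ultrapower U (bddFamilyMap I T x))
    ((tendsto_norm_ultrapower U (bddFamilyMap I j x)).add
      ((tendsto_norm_ultrapower U x).const_mul ε)) fun i => h (x i)

end Ultrapower

/-! ### Rosenthal's lemma and weakly unconditionally Cauchy series -/

section Rosenthal

/-- **Rosenthal's lemma**: a nonnegative matrix with uniformly bounded row sums has an infinite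
principal submatrix whose off-diagonal row sums are at most `ε`. -/
theorem exists_injective_tsum_offDiag_le {ε : ℝ≥0∞} (k : ℕ) (a : ℕ → ℕ → ℝ≥0∞)
    (h : ∀ n, ∑' m, (if m = n then 0 else a n m) ≤ k * ε) :
    ∃ s : ℕ → ℕ, Function.Injective s ∧
      ∀ n, ∑' m, (if m = n then 0 else a (s n) (s m)) ≤ ε := by
  induction k generalizing a with
  | zero => exact ⟨id, Function.injective_id, fun n => (h n).trans (by simp)⟩
  | succ k ih =>
    have hinj : ∀ p, Function.Injective (Nat.pair p) := fun p q r hqr =>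
      (Nat.pair_eq_pair.1 hqr).2
    -- The pairing function splits `ℕ` into infinitely many infinite blocks. Either some block
    -- already works, or each block `p` has a row `t p` whose off-diagonal sum inside the block
    -- exceeds `ε`. The other `t p'` lie outside block `p`, so restricting to `t` lowers the bound
    -- from `(k + 1) ε` to `k ε`.
    by_cases hp : ∃ p, ∀ q, ∑' r, (if r = q then 0 else a (Nat.pair p q) (Nat.pair p r)) ≤ ε
    · obtain ⟨p, hp⟩ := hp
      exact ⟨_, hinj p, hp⟩
    · push Not at hp
      choose q hq using hp
      let t : ℕ → ℕ := fun p => Nat.pair p (q p)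
      have ht : Function.Injective t := fun p p' hpp => (Nat.pair_eq_pair.1 hpp).1
      obtain ⟨s, hs, hs'⟩ := ih (fun p p' => a (t p) (t p')) fun p => by
        let g : ℕ → ℝ≥0∞ := fun m => if m = t p then 0 else a (t p) m
        let A : Set ℕ := range (Nat.pair p)
        have h1 : ∑' p', (if p' = p then 0 else a (t p) (t p')) ≤ ∑' m, Aᶜ.indicator g m := by
          refine le_trans (ENNReal.tsum_le_tsum fun p' => ?_)
            (ENNReal.tsum_comp_le_tsum_of_injective ht (Aᶜ.indicator g))
          split_ifs with hpp
          · exact zero_le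
          · have : t p' ∈ Aᶜ := by
              rintro ⟨r, hr⟩
              exact hpp (Nat.pair_eq_pair.1 hr).1.symm
            rw [indicator_of_mem this]
            simp [g, ht.eq_iff, hpp]
        have h2 : ∑' r, (if r = q p then 0 else a (t p) (Nat.pair p r)) ≤
            ∑' m, A.indicator g m := by
          refine le_trans (ENNReal.tsum_le_tsum fun r => ?_)
            (ENNReal.tsum_comp_le_tsum_of_injective (hinj p) (A.indicator g))
          rw [indicator_of_mem (mem_range_self r)]
          simp only [g, t, (hinj p).eq_iff]
          exact le_rfl
        have h3 := (add_le_add h1 h2).trans_eq ENNReal.tsum_add.symm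
        simp only [indicator_compl_add_self_apply] at h3
        have h4 := h3.trans (h (t p))
        by_contra hlt
        rw [not_le] at hlt
        refine absurd h4 (not_le.2 ?_)
        rw [Nat.cast_succ, add_mul, one_mul]
        exact ENNReal.add_lt_add hlt (hq p)
      exact ⟨t ∘ s, ht.comp hs, hs'⟩

variable {E : Type*} [NormedAddCommGroup E] [NormedSpace ℝ E]

/-- The tail sums of a weakly unconditionally Cauchy series of functionals. -/
theorem exists_tail_sum {q : ℕ → StrongDual ℝ E} {C : ℝ}
    (hq : ∀ (s : Finset ℕ) (y : E), ∑ n ∈ s, |q n y| ≤ C * ‖y‖) :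
    ∃ Q : ℕ → StrongDual ℝ E, ∀ k y, HasSum (fun m => q (m + k) y) (Q k y) := by
  have hqs : ∀ (k : ℕ) (y : E) (F : Finset ℕ), ∑ m ∈ F, |q (m + k) y| ≤ C * ‖y‖ := fun k y F =>
    le_of_eq_of_le (by rw [Finset.sum_map]; rfl) (hq (F.map (addRightEmbedding k)) y)
  have habs : ∀ k y, Summable fun m => |q (m + k) y| := fun k y =>
    summable_of_sum_le (fun _ => abs_nonneg _) (hqs k y)
  have hsum : ∀ k y, Summable fun m => q (m + k) y := fun k y => (habs k y).of_abs
  refine ⟨fun k => LinearMap.mkContinuous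
    { toFun := fun y => ∑' m, q (m + k) y
      map_add' := fun y z => by simp [(hsum k y).tsum_add (hsum k z)]
      map_smul' := fun c y => by simp [tsum_mul_left] } C fun y => ?_,
    fun k y => (hsum k y).hasSum⟩
  exact (norm_tsum_le_tsum_norm (f := fun m => q (m + k) y) (habs k y)).trans
    ((habs k y).tsum_le_of_sum_le (hqs k y))

/-- The tail sums satisfy `Q k (x n) ≥ δ / 2` for `n ≥ k`, hence `Q k z ≥ δ / 2` at a weak limit `z`
of the `x n` along a free ultrafilter. But `Q k z` is the tail of a convergent series and tends to
`0`. -/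
theorem IsRelativelyWeaklyCompact.not_forall_le_apply_of_offDiag {S : Set E}
    (hS : IsRelativelyWeaklyCompact S) {x : ℕ → E} (hx : ∀ n, x n ∈ S)
    {q : ℕ → StrongDual ℝ E} {C : ℝ}
    (hq : ∀ (s : Finset ℕ) (y : E), ∑ n ∈ s, |q n y| ≤ C * ‖y‖) {δ : ℝ} (hδ : 0 < δ)
    (hoff : ∀ (n : ℕ) (F : Finset ℕ), n ∉ F → ∑ m ∈ F, |q m (x n)| ≤ δ / 2) :
    ¬ ∀ n, δ ≤ q n (x n) := by
  intro hqx
  obtain ⟨Q, hQ⟩ := exists_tail_sum hq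
  obtain ⟨z, hz⟩ := hS.exists_tendstoWeakly (hyperfilter ℕ) (u := x) (Eventually.of_forall hx)
  have hQx : ∀ k n, k ≤ n → δ / 2 ≤ Q k (x n) := by
    intro k n hkn
    refine ge_of_tendsto (hQ k (x n)) ?_
    filter_upwards [eventually_ge_atTop {n - k}] with F hF
    have hmem : n - k ∈ F := Finset.singleton_subset_iff.1 hF
    rw [← Finset.add_sum_erase F _ hmem, Nat.sub_add_cancel hkn]
    have h1 := hoff n ((F.erase (n - k)).map (addRightEmbedding k)) (by
      intro hn
      obtain ⟨m, hm, hmn⟩ := Finset.mem_map.1 hn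
      rw [addRightEmbedding_apply] at hmn
      exact Finset.ne_of_mem_erase hm (by omega))
    rw [Finset.sum_map] at h1
    have h2 := (Finset.abs_sum_le_sum_abs (fun m => q (m + k) (x n)) (F.erase (n - k))).trans h1
    linarith [hqx n, (abs_le.1 h2).1]
  have hQz : ∀ k, δ / 2 ≤ Q k z := fun k => ge_of_tendsto (hz (Q k))
    (((eventually_ge_atTop k).filter_mono Nat.hyperfilter_le_atTop).mono fun n hn => hQx k n hn)
  have hlim : Tendsto (fun k => Q k z) atTop (𝓝 0) := by
    simpa only [(hQ _ z).tsum_eq] using tendsto_sum_nat_add fun m => q m z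
  exact absurd (ge_of_tendsto' hlim hQz) (by linarith)

/-- On a relatively weakly compact set, a weakly unconditionally Cauchy series of functionals
cannot be bounded below along the diagonal. -/
theorem IsRelativelyWeaklyCompact.not_forall_le_apply {S : Set E}
    (hS : IsRelativelyWeaklyCompact S) {x : ℕ → E} (hx : ∀ n, x n ∈ S)
    {q : ℕ → StrongDual ℝ E} {C : ℝ} (hC : 0 ≤ C)
    (hq : ∀ (s : Finset ℕ) (y : E), ∑ n ∈ s, |q n y| ≤ C * ‖y‖) {δ : ℝ} (hδ : 0 < δ) :
    ¬ ∀ n, δ ≤ q n (x n) := by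
  intro hqx
  obtain ⟨M, hM⟩ := hS.exists_norm_le
  obtain ⟨k, hk⟩ := exists_nat_ge (C * M / (δ / 2))
  rw [div_le_iff₀ (half_pos hδ)] at hk
  obtain ⟨s, hs, hoff⟩ := exists_injective_tsum_offDiag_le (ε := ENNReal.ofReal (δ / 2))
    k (fun n m => ENNReal.ofReal |q m (x n)|) fun n => by
      refine ENNReal.summable.tsum_le_of_sum_le fun F => ?_
      calc ∑ m ∈ F, (if m = n then 0 else ENNReal.ofReal |q m (x n)|)
          ≤ ∑ m ∈ F, ENNReal.ofReal |q m (x n)| :=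
            Finset.sum_le_sum fun m _ => by split_ifs <;> simp
        _ = ENNReal.ofReal (∑ m ∈ F, |q m (x n)|) :=
            (ENNReal.ofReal_sum_of_nonneg fun _ _ => abs_nonneg _).symm
        _ ≤ ENNReal.ofReal (k * (δ / 2)) :=
            ENNReal.ofReal_le_ofReal ((hq F _).trans
              ((mul_le_mul_of_nonneg_left (hM _ (hx n)) hC).trans hk))
        _ = k * ENNReal.ofReal (δ / 2) := by
            rw [ENNReal.ofReal_mul (Nat.cast_nonneg k), ENNReal.ofReal_natCast]
  refine hS.not_forall_le_apply_of_offDiag (x := x ∘ s) (fun n => hx _) (q := q ∘ s) (C := C)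
    (fun F y => ?_) hδ (fun n F hn => ?_) fun n => hqx (s n)
  · exact le_of_eq_of_le (by rw [Finset.sum_map]; rfl) (hq (F.map ⟨s, hs⟩) y)
  · rw [← ENNReal.ofReal_le_ofReal_iff (half_pos hδ).le,
      ENNReal.ofReal_sum_of_nonneg fun _ _ => abs_nonneg _]
    refine le_trans (Finset.sum_le_sum fun m hm => ?_) ((ENNReal.sum_le_tsum F).trans (hoff n))
    rw [if_neg (ne_of_mem_of_not_mem hm hn)]
    rfl

end Rosenthal

/-! ### Weakly compact sets in L¹ -/

section IntegrableFunctions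

variable {Ω : Type*} [MeasurableSpace Ω] {μ : Measure Ω}

/-- Integration over a set, as a continuous functional on `L¹`. -/
noncomputable def setIntegralL1 (μ : Measure Ω) (s : Set Ω) : StrongDual ℝ (Lp ℝ 1 μ) :=
  LinearMap.mkContinuous
    { toFun := fun y => ∫ ω in s, y ω ∂μ
      map_add' := fun y z => by
        rw [← integral_add (L1.integrable_coeFn y).integrableOn
          (L1.integrable_coeFn z).integrableOn]
        exact integral_congr_ae (ae_restrict_of_ae (Lp.coeFn_add y z))
      map_smul' := fun c y => by
        rw [RingHom.id_apply, smul_eq_mul, ← integral_const_mul]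
        exact integral_congr_ae (ae_restrict_of_ae (Lp.coeFn_smul c y)) } 1 fun y => by
    rw [one_mul, L1.norm_eq_integral_norm]
    exact (norm_integral_le_integral_norm _).trans (setIntegral_le_integral
      (L1.integrable_coeFn y).norm (Eventually.of_forall fun _ => norm_nonneg _))

theorem setIntegralL1_apply (s : Set Ω) (y : Lp ℝ 1 μ) :
    setIntegralL1 μ s y = ∫ ω in s, y ω ∂μ := rfl

theorem setIntegral_abs_le_norm (s : Set Ω) (y : Lp ℝ 1 μ) : ∫ ω in s, |y ω| ∂μ ≤ ‖y‖ := by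
  rw [L1.norm_eq_integral_norm]
  exact setIntegral_le_integral (L1.integrable_coeFn y).abs
    (Eventually.of_forall fun _ => abs_nonneg _)

/-- Integration against the sign of `x` over a set, as a continuous functional on `L¹`. -/
noncomputable def signIntegralL1 (x : Lp ℝ 1 μ) (s : Set Ω) : StrongDual ℝ (Lp ℝ 1 μ) :=
  setIntegralL1 μ (s ∩ {ω | 0 ≤ x ω}) - setIntegralL1 μ (s \ {ω | 0 ≤ x ω})

theorem measurableSet_nonneg_coeFn (x : Lp ℝ 1 μ) : MeasurableSet {ω | 0 ≤ x ω} :=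
  measurableSet_le measurable_const (Lp.stronglyMeasurable x).measurable

theorem abs_signIntegralL1_le (x y : Lp ℝ 1 μ) (s : Set Ω) :
    |signIntegralL1 x s y| ≤ ∫ ω in s, |y ω| ∂μ := by
  rw [← integral_inter_add_sdiff (measurableSet_nonneg_coeFn x)
    (L1.integrable_coeFn y).abs.integrableOn]
  refine (abs_sub _ _).trans (add_le_add ?_ ?_) <;>
  exact norm_integral_le_integral_norm fun ω => y ω

theorem signIntegralL1_self (x : Lp ℝ 1 μ) {s : Set Ω} (hs : MeasurableSet s) :
    signIntegralL1 x s x = ∫ ω in s, |x ω| ∂μ := by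
  rw [← integral_inter_add_sdiff (measurableSet_nonneg_coeFn x)
    (L1.integrable_coeFn x).abs.integrableOn, signIntegralL1, sub_apply,
    setIntegralL1_apply, setIntegralL1_apply, sub_eq_add_neg, ← integral_neg]
  congr 1
  · exact setIntegral_congr_fun (hs.inter (measurableSet_nonneg_coeFn x))
      fun ω hω => (abs_of_nonneg hω.2).symm
  · exact setIntegral_congr_fun (hs.diff (measurableSet_nonneg_coeFn x))
      fun ω hω => (abs_of_neg (not_le.1 hω.2)).symm

theorem setIntegral_iUnion_le_tsum {f : Ω → ℝ} (hf : Integrable f μ) (hf0 : ∀ ω, 0 ≤ f ω)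
    (A : ℕ → Set Ω) {b : ℕ → ℝ} (hb : Summable b) (h : ∀ n, ∫ ω in A n, f ω ∂μ ≤ b n) :
    ∫ ω in ⋃ n, A n, f ω ∂μ ≤ ∑' n, b n := by
  have hb0 : ∀ n, 0 ≤ b n := fun n => (integral_nonneg hf0).trans (h n)
  have hof : ∀ s : Set Ω, ENNReal.ofReal (∫ ω in s, f ω ∂μ) = ∫⁻ ω in s, ENNReal.ofReal (f ω) ∂μ :=
    fun s => ofReal_integral_eq_lintegral_ofReal hf.integrableOn (Eventually.of_forall hf0)
  rw [← ENNReal.ofReal_le_ofReal_iff (tsum_nonneg hb0), hof, ENNReal.ofReal_tsum_of_nonneg hb0 hb]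
  refine (lintegral_iUnion_le _ _).trans (ENNReal.tsum_le_tsum fun n => ?_)
  rw [← hof]
  exact ENNReal.ofReal_le_ofReal (h n)

/-- Relatively weakly compact subsets of `L¹` are almost order bounded. -/
theorem IsRelativelyWeaklyCompact.exists_setIntegral_le {S : Set (Lp ℝ 1 μ)}
    (hS : IsRelativelyWeaklyCompact S) {ε : ℝ} (hε : 0 < ε) :
    ∃ g : Ω → ℝ, Measurable g ∧ Integrable g μ ∧
      ∀ f ∈ S, ∫ ω in {ω | g ω < |f ω|}, |f ω| ∂μ ≤ ε := by
  by_contra! hne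
  obtain ⟨M₀, hM₀⟩ := hS.exists_norm_le
  obtain ⟨M, hM0, hM⟩ : ∃ M > 0, ∀ x ∈ S, ‖x‖ ≤ M :=
    ⟨max M₀ 1, by positivity, fun x hx => (hM₀ x hx).trans (le_max_left _ _)⟩
  choose! pick hpickS hpick using hne
  have hmeas : ∀ x : Lp ℝ 1 μ, Measurable x := fun x => (Lp.stronglyMeasurable x).measurable
  have hint : ∀ x : Lp ℝ 1 μ, Integrable (fun ω => |x ω|) μ := fun x => (L1.integrable_coeFn x).abs
  -- Chosen so that the geometric series `∑ (M / c) 2⁻ʲ` of `htail` sums to `ε / 2`.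
  let c : ℝ := 4 * M / ε
  have hc : 0 < c := by positivity
  -- The factor `2` makes `G (k + j + 1) ≥ 2 ^ j c |x k|`, so `|x k|` has geometrically small
  -- integral over the later sets `A n`, where `|x n| > G n`.
  let G : ℕ → {g : Ω → ℝ // Measurable g ∧ Integrable g μ ∧ ∀ ω, 0 ≤ g ω} := fun n =>
    Nat.rec ⟨0, measurable_const, integrable_zero _ _ _, fun _ => le_rfl⟩ (fun _ g =>
      ⟨fun ω => 2 * g.1 ω + c * |pick g.1 ω|,
        (g.2.1.const_mul 2).add ((hmeas _).abs.const_mul c),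
        (g.2.2.1.const_mul 2).add ((hint _).const_mul c),
        fun ω => by have := g.2.2.2 ω; positivity⟩) n
  let x : ℕ → Lp ℝ 1 μ := fun n => pick (G n).1
  have hxS : ∀ n, x n ∈ S := fun n => hpickS _ (G n).2.1 (G n).2.2.1
  have hGs : ∀ n ω, (G (n + 1)).1 ω = 2 * (G n).1 ω + c * |x n ω| := fun n ω => rfl
  have hG : ∀ k j ω, 2 ^ j * c * |x k ω| ≤ (G (k + j + 1)).1 ω := by
    intro k j ω
    induction j with
    | zero =>
      have := (G k).2.2.2 ω
      rw [add_zero, hGs]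
      linarith
    | succ j ih =>
      have : 0 ≤ c * |x (k + (j + 1)) ω| := by positivity
      rw [hGs, pow_succ]
      rw [← add_assoc] at this ⊢
      linarith
  let A : ℕ → Set Ω := fun n => {ω | (G n).1 ω < |x n ω|}
  have hA : ∀ n, MeasurableSet (A n) := fun n => measurableSet_lt (G n).2.1 (hmeas _).abs
  have hAx : ∀ n, ε < ∫ ω in A n, |x n ω| ∂μ := fun n => hpick _ (G n).2.1 (G n).2.2.1
  have hsmall : ∀ k j, ∫ ω in A (k + 1 + j), |x k ω| ∂μ ≤ M / c * (1 / 2) ^ j := by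
    intro k j
    rw [show k + 1 + j = k + j + 1 by ring]
    have h1 : 2 ^ j * c * ∫ ω in A (k + j + 1), |x k ω| ∂μ ≤ M := by
      rw [← integral_const_mul]
      have h0 : ∀ ω ∈ A (k + j + 1), 2 ^ j * c * |x k ω| ≤ |x (k + j + 1) ω| :=
        fun ω hω => (hG k j ω).trans (le_of_lt hω)
      exact (setIntegral_mono_on ((hint (x k)).const_mul (2 ^ j * c)).integrableOn
        (hint (x (k + j + 1))).integrableOn (hA (k + j + 1)) h0).trans ((setIntegral_abs_le_norm _ _).trans
          (hM _ (hxS (k + j + 1))))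
    have h2 : (0 : ℝ) < 2 ^ j * c := by positivity
    rw [mul_comm, ← le_div_iff₀ h2] at h1
    refine h1.trans_eq ?_
    rw [one_div, inv_pow]
    field_simp
  have htail : ∀ k, ∫ ω in ⋃ j, A (k + 1 + j), |x k ω| ∂μ ≤ ε / 2 := fun k => by
    refine (setIntegral_iUnion_le_tsum (hint _) (fun _ => abs_nonneg _) _
      (summable_geometric_two.mul_left _) (hsmall k)).trans_eq ?_
    rw [tsum_mul_left, tsum_geometric_two]
    simp only [c]
    field_simp
    norm_num
  -- Removing all later sets makes the `B n` disjoint at a cost of at most `ε / 2` in the integral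
  -- of `|x n|`.
  let B : ℕ → Set Ω := fun n => A n \ ⋃ j, A (n + 1 + j)
  have hB : ∀ n, MeasurableSet (B n) := fun n => (hA n).diff (MeasurableSet.iUnion fun j => hA _)
  have hBd : Pairwise (Function.onFun Disjoint B) := by
    refine (pairwise_disjoint_on B).2 fun m n hmn => ?_
    refine disjoint_left.2 fun ω hm hn => hm.2 (mem_iUnion.2 ⟨n - (m + 1), ?_⟩)
    rw [Nat.add_sub_cancel' hmn]
    exact hn.1
  refine hS.not_forall_le_apply hxS (q := fun n => signIntegralL1 (x n) (B n)) zero_le_one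
    (fun s y => ?_) (half_pos hε) fun n => ?_
  · rw [one_mul]
    refine (Finset.sum_le_sum fun n _ => abs_signIntegralL1_le _ _ _).trans ?_
    rw [← integral_biUnion_finset s (fun n _ => hB n) (fun m _ n _ h => hBd h)
      fun n _ => (hint y).integrableOn]
    exact setIntegral_abs_le_norm _ _
  · rw [signIntegralL1_self _ (hB n)]
    have h1 : ∫ ω in A n, |x n ω| ∂μ ≤
        ∫ ω in B n, |x n ω| ∂μ + ∫ ω in ⋃ j, A (n + 1 + j), |x n ω| ∂μ := by
      rw [← integral_inter_add_sdiff (MeasurableSet.iUnion fun j => hA (n + 1 + j))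
        (hint _).integrableOn, add_comm]
      refine add_le_add_right (setIntegral_mono_set (hint _).integrableOn
        (Eventually.of_forall fun _ => abs_nonneg _) ?_) _
      exact Eventually.of_forall fun _ h => h.2
    linarith [hAx n, htail n]

/-- A relatively weakly compact subset of `L¹` is norm-approximable by images of Hilbert balls. -/
theorem IsRelativelyWeaklyCompact.exists_hilbert_approx_L1 {S : Set (Lp ℝ 1 μ)}
    (hS : IsRelativelyWeaklyCompact S) {ε : ℝ} (hε : 0 < ε) :
    ∃ (R : Lp ℝ 2 μ →L[ℝ] Lp ℝ 1 μ) (r : ℝ), ∀ f ∈ S, ∃ y, ‖y‖ ≤ r ∧ ‖f - R y‖ ≤ ε := by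
  obtain ⟨g, hgm, hgi, hg⟩ := hS.exists_setIntegral_le hε
  -- Where `g` is negative, `√(g ω)` is `0`, so its square is the positive part of `g`. Such points
  -- lie in `D`.
  have hsq : MemLp (fun ω => √(g ω)) 2 μ := by
    refine (memLp_two_iff_integrable_sq hgm.sqrt.aestronglyMeasurable).2 (hgi.pos_part.congr ?_)
    exact Eventually.of_forall fun ω => (Real.sq_sqrt' (x := g ω)).symm
  refine ⟨(ContinuousLinearMap.mul ℝ ℝ).holderL μ 2 2 1 hsq.toLp, ‖hsq.toLp‖, fun f hf => ?_⟩
  let D : Set Ω := {ω | g ω < |f ω|}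
  have hfm : Measurable f := (Lp.stronglyMeasurable f).measurable
  have hD : MeasurableSet D := measurableSet_lt hgm hfm.abs
  -- The part of `f` below `g` factors as `√g * h` with `|h| ≤ √g`. Division by zero is harmless:
  -- off `D`, `√g = 0` forces `f = 0`.
  let h : Ω → ℝ := Dᶜ.indicator fun ω => f ω / √(g ω)
  have hle : ∀ ω, ‖h ω‖ ≤ ‖√(g ω)‖ := by
    intro ω
    by_cases hω : ω ∈ D
    · simp [h, hω]
    · have h1 : |f ω| ≤ g ω := not_lt.1 hω
      simp only [h, indicator_of_mem (mem_compl hω), norm_div, Real.norm_eq_abs]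
      refine div_le_of_le_mul₀ (abs_nonneg _) (abs_nonneg _) ?_
      rwa [← abs_mul, Real.mul_self_sqrt ((abs_nonneg _).trans h1),
        abs_of_nonneg ((abs_nonneg _).trans h1)]
  have hmul : ∀ ω, √(g ω) * h ω = Dᶜ.indicator f ω := by
    intro ω
    by_cases hω : ω ∈ D
    · simp [h, hω]
    · have h1 : |f ω| ≤ g ω := not_lt.1 hω
      simp only [h, indicator_of_mem (mem_compl hω)]
      rcases eq_or_ne (√(g ω)) 0 with h0 | h0
      · rw [Real.sqrt_eq_zero ((abs_nonneg _).trans h1)] at h0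
        have : f ω = 0 := abs_nonpos_iff.1 (h0 ▸ h1)
        simp [this]
      · exact mul_div_cancel₀ _ h0
  have hhm : AEStronglyMeasurable h μ :=
    ((hfm.div hgm.sqrt).indicator hD.compl).aestronglyMeasurable
  have hh : MemLp h 2 μ := hsq.mono hhm (Eventually.of_forall hle)
  refine ⟨hh.toLp, ?_, ?_⟩
  · refine Lp.norm_le_norm_of_ae_le ?_
    filter_upwards [hh.coeFn_toLp, hsq.coeFn_toLp] with ω h1 h2
    rw [h1, h2]
    exact hle ω
  · refine le_trans (le_of_eq ?_) (hg f hf)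
    rw [L1.norm_eq_integral_norm, ← integral_indicator hD]
    refine integral_congr_ae ?_
    filter_upwards [hh.coeFn_toLp, hsq.coeFn_toLp, Lp.coeFn_sub f
      ((ContinuousLinearMap.mul ℝ ℝ).holderL μ 2 2 1 hsq.toLp hh.toLp),
      (ContinuousLinearMap.mul ℝ ℝ).coeFn_holder (r := 1) hsq.toLp hh.toLp] with ω h1 h2 h3 h4
    rw [h3, Pi.sub_apply, ContinuousLinearMap.holderL_apply_apply, h4, h1, h2,
      ContinuousLinearMap.mul_apply', hmul]
    by_cases hω : ω ∈ D
    · simp [hω]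
    · simp [hω]

end IntegrableFunctions

/-! ### Splitting functionals, and the modulus of a functional on `C(K)` -/

section ContinuousFunctions

/-- Hahn–Banach in `H × E`: `ν` is viewed as a functional on the graph of `j`, dominated there by
`‖h‖ + ε ‖u‖`. An extension restricts to a functional of norm at most `1` on `H` and of norm at most
`ε` on `E`; their sum recovers `ν` on the graph. -/
theorem exists_hilbert_split {E H : Type*} [NormedAddCommGroup E] [NormedSpace ℝ E]
    [NormedAddCommGroup H] [InnerProductSpace ℝ H] [CompleteSpace H] (j : E →L[ℝ] H)
    {ν : StrongDual ℝ E} {ε : ℝ} (hε : 0 ≤ ε) (hν : ∀ u, |ν u| ≤ ‖j u‖ + ε * ‖u‖) :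
    ∃ h : H, ‖h‖ ≤ 1 ∧ ‖ν - (innerSL ℝ h).comp j‖ ≤ ε := by
  let f : (H × E) →ₗ.[ℝ] ℝ :=
    ⟨LinearMap.eqLocus (LinearMap.fst ℝ H E) (j.toLinearMap ∘ₗ LinearMap.snd ℝ H E),
      ν.toLinearMap ∘ₗ LinearMap.snd ℝ H E ∘ₗ Submodule.subtype _⟩
  obtain ⟨g, hgf, hg⟩ := exists_extension_of_le_sublinear f (fun p => ‖p.1‖ + ε * ‖p.2‖)
    (fun c hc p => by simp [norm_smul, abs_of_pos hc]; ring)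
    (fun p q => by
      have h1 := norm_add_le p.1 q.1
      have h2 := mul_le_mul_of_nonneg_left (norm_add_le p.2 q.2) hε
      simp only [Prod.fst_add, Prod.snd_add]
      linarith)
    (fun p => by
      have hp : p.1.1 = j p.1.2 := p.2
      change ν p.1.2 ≤ _
      rw [hp]
      exact (le_abs_self _).trans (hν _))
  have habs : ∀ p, |g p| ≤ ‖p.1‖ + ε * ‖p.2‖ := fun p => abs_le.2
    ⟨by have := hg (-p); simp only [map_neg, Prod.fst_neg, Prod.snd_neg, norm_neg] at this; linarith,
      hg p⟩
  have h1 : ∀ h : H, ‖(g ∘ₗ LinearMap.inl ℝ H E) h‖ ≤ 1 * ‖h‖ := fun h => by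
    simpa using habs (h, 0)
  refine ⟨(InnerProductSpace.toDual ℝ H).symm (LinearMap.mkContinuous _ 1 h1), ?_, ?_⟩
  · rw [LinearIsometryEquiv.norm_map]
    exact LinearMap.mkContinuous_norm_le _ zero_le_one _
  · refine ContinuousLinearMap.opNorm_le_bound _ hε fun u => ?_
    have h2 : ν u = g (j u, u) := (hgf ⟨(j u, u), rfl⟩).symm
    have h3 : g (j u, u) = g (j u, 0) + g (0, u) := by
      rw [← map_add]
      simp
    have h4 := habs (0, u)
    simp only [norm_zero, zero_add] at h4
    rw [sub_apply, h2, h3, ContinuousLinearMap.comp_apply, innerSL_apply_apply,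
      InnerProductSpace.toDual_symm_apply]
    simpa using h4

variable {K : Type*} [TopologicalSpace K]

/-- The modulus of a functional on `C(K)`, evaluated at a nonnegative function. -/
noncomputable def dualModulus (ν : StrongDual ℝ C(K, ℝ)) (u : K → ℝ) : ℝ :=
  sSup (ν '' {w | ∀ x, |w x| ≤ u x})

theorem dualModulus_le {ν : StrongDual ℝ C(K, ℝ)} {u : K → ℝ} (hu : ∀ x, 0 ≤ u x) {C : ℝ}
    (h : ∀ w : C(K, ℝ), (∀ x, |w x| ≤ u x) → ν w ≤ C) : dualModulus ν u ≤ C := by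
  refine csSup_le ⟨_, mem_image_of_mem ν (x := 0) (by simpa using hu)⟩ ?_
  rintro _ ⟨w, hw, rfl⟩
  exact h w hw

variable [CompactSpace K]

theorem le_norm_of_abs_le {w : C(K, ℝ)} {C : ℝ} (hC : 0 ≤ C) (h : ∀ x, |w x| ≤ C)
    (ν : StrongDual ℝ C(K, ℝ)) : ν w ≤ ‖ν‖ * C :=
  (le_abs_self _).trans (ν.le_of_opNorm_le_of_le le_rfl ((ContinuousMap.norm_le _ hC).2 h))

theorem apply_le_dualModulus (ν : StrongDual ℝ C(K, ℝ)) {u w : C(K, ℝ)}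
    (h : ∀ x, |w x| ≤ u x) : ν w ≤ dualModulus ν u := by
  refine le_csSup ⟨‖ν‖ * ‖u‖, ?_⟩ (mem_image_of_mem _ h)
  rintro _ ⟨v, hv, rfl⟩
  exact le_norm_of_abs_le (norm_nonneg _)
    (fun x => (hv x).trans ((le_abs_self _).trans (u.norm_coe_le_norm x))) ν

theorem dualModulus_nonneg (ν : StrongDual ℝ C(K, ℝ)) {u : C(K, ℝ)} (hu : ∀ x, 0 ≤ u x) :
    0 ≤ dualModulus ν u := by
  simpa using apply_le_dualModulus ν (u := u) (w := 0) (by simpa using hu)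

/-- For `≤`, Riesz decomposition: if `|w| ≤ u + v`, clamping `w` to `[-u, u]` leaves a remainder
bounded by `v`. -/
theorem dualModulus_add (ν : StrongDual ℝ C(K, ℝ)) {u v : C(K, ℝ)} (hu : ∀ x, 0 ≤ u x)
    (hv : ∀ x, 0 ≤ v x) :
    dualModulus ν (u + v : C(K, ℝ)) = dualModulus ν u + dualModulus ν v := by
  refine le_antisymm (dualModulus_le (fun x => add_nonneg (hu x) (hv x)) fun w hw => ?_) ?_
  · have h1 := apply_le_dualModulus ν (u := u) (w := (w ⊓ u) ⊔ (-u)) fun x => by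
      simpa [abs_le] using hu x
    have h2 := apply_le_dualModulus ν (u := v) (w := w - (w ⊓ u) ⊔ (-u)) fun x => by
      have : -(u x + v x) ≤ w x ∧ w x ≤ u x + v x := abs_le.1 (hw x)
      have h3 := hv x
      have h4 := hu x
      simp only [ContinuousMap.sub_apply, ContinuousMap.sup_apply, ContinuousMap.inf_apply,
        ContinuousMap.neg_apply]
      rw [abs_le]
      rcases min_cases (w x) (u x) with h | h <;>
        rcases max_cases (min (w x) (u x)) (-u x) with h' | h' <;> constructor <;> linarith
    rw [map_sub] at h2
    linarith
  · rw [← le_sub_iff_add_le]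
    refine dualModulus_le hu fun w hw => ?_
    rw [le_sub_comm]
    refine dualModulus_le hv fun z hz => ?_
    rw [le_sub_iff_add_le, ← map_add]
    exact apply_le_dualModulus ν fun x => (abs_add_le _ _).trans
      ((add_comm (|z x|) _).trans_le (add_le_add (hw x) (hz x)))

theorem dualModulus_smul (ν : StrongDual ℝ C(K, ℝ)) {u : C(K, ℝ)} (hu : ∀ x, 0 ≤ u x) {c : ℝ}
    (hc : 0 ≤ c) : dualModulus ν (c • u : C(K, ℝ)) = c * dualModulus ν u := by
  have key : ∀ v : C(K, ℝ), (∀ x, 0 ≤ v x) → ∀ b : ℝ, 0 < b →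
      b * dualModulus ν v ≤ dualModulus ν (b • v : C(K, ℝ)) := by
    intro v hv b hb
    rw [← le_div_iff₀' hb]
    refine dualModulus_le hv fun w hw => ?_
    rw [le_div_iff₀' hb, ← smul_eq_mul, ← map_smul]
    exact apply_le_dualModulus ν fun x => by
      simpa [abs_mul, abs_of_pos hb] using mul_le_mul_of_nonneg_left (hw x) hb.le
  rcases hc.eq_or_lt with rfl | hc
  · rw [zero_mul, zero_smul]
    refine le_antisymm (dualModulus_le (fun x => le_rfl) fun w hw => ?_)
      (dualModulus_nonneg ν fun x => le_rfl)
    have : w = 0 := by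
      ext x
      simpa using hw x
    simp [this]
  · refine le_antisymm ?_ (key u hu c hc)
    have := key (c • u) (fun x => mul_nonneg hc.le (hu x)) c⁻¹ (inv_pos.2 hc)
    rwa [inv_smul_smul₀ hc.ne', inv_mul_le_iff₀ hc] at this

variable [T2Space K] [MeasurableSpace K] [BorelSpace K]

open scoped NNReal CompactlySupported

/-- Functionals on `C(K)` are dominated by finite measures of at most the same mass. -/
theorem exists_dominating_measure (ν : StrongDual ℝ C(K, ℝ)) :
    ∃ m : Measure K, IsFiniteMeasure m ∧ m.real univ ≤ ‖ν‖ ∧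
      ∀ w u : C(K, ℝ), (∀ x, |w x| ≤ u x) → ν w ≤ ∫ x, u x ∂m := by
  let toReal : C_c(K, ℝ≥0) → C(K, ℝ) := fun u => ⟨fun x => u x, by fun_prop⟩
  have hpos : ∀ u x, 0 ≤ toReal u x := fun u x => (u x).2
  -- The modulus is additive and homogeneous on nonnegative functions, so the Riesz–Markov–Kakutani
  -- theorem represents it by a measure.
  let Λ : C_c(K, ℝ≥0) →ₗ[ℝ≥0] ℝ≥0 :=
    { toFun := fun u => ⟨dualModulus ν (toReal u), dualModulus_nonneg ν (hpos u)⟩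
      map_add' := fun u v => by
        ext
        exact dualModulus_add ν (hpos u) (hpos v)
      map_smul' := fun c u => by
        ext
        exact dualModulus_smul ν (hpos u) c.2 }
  have hΛ : ∀ u : C(K, ℝ), (∀ x, 0 ≤ u x) →
      ∫ x, u x ∂(NNRealRMK.rieszMeasure Λ) = dualModulus ν u := by
    intro u hu
    let v : C_c(K, ℝ≥0) :=
      ⟨⟨fun x => (u x).toNNReal, by fun_prop⟩, HasCompactSupport.of_compactSpace _⟩
    have hv : ∀ x, (v x : ℝ) = u x := fun x => Real.coe_toNNReal _ (hu x)
    have := NNRealRMK.integral_rieszMeasure Λ v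
    simp only [hv] at this
    rw [this]
    change dualModulus ν (toReal v) = _
    congr 1
    exact funext hv
  refine ⟨NNRealRMK.rieszMeasure Λ, inferInstance, ?_, fun w u h => ?_⟩
  · have h1 := hΛ 1 fun x => zero_le_one
    simp only [ContinuousMap.one_apply, integral_const, smul_eq_mul, mul_one] at h1
    rw [h1]
    exact dualModulus_le (fun x => zero_le_one) fun w hw =>
      (le_norm_of_abs_le zero_le_one hw ν).trans_eq (mul_one _)
  · rw [hΛ u fun x => (abs_nonneg _).trans (h x)]
    exact apply_le_dualModulus ν h

end ContinuousFunctions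

/-! ### Weakly compact sets in `C(K)*` -/

section DualOfContinuousFunctions

open scoped NNReal

variable {K : Type*} [TopologicalSpace K]

/-- The part of `u` that exceeds the threshold `s` in absolute value. -/
def softThreshold (u s : C(K, ℝ)) : C(K, ℝ) := u - ((u ⊓ s) ⊔ (-s))

theorem softThreshold_apply (u s : C(K, ℝ)) (x : K) :
    softThreshold u s x = u x - max (min (u x) (s x)) (-s x) := rfl

theorem abs_sub_softThreshold_le {u s : C(K, ℝ)} (hs : ∀ x, 0 ≤ s x) (x : K) :
    |(u - softThreshold u s) x| ≤ s x := by
  have := hs x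
  rw [ContinuousMap.sub_apply, softThreshold_apply, sub_sub_cancel, abs_le]
  exact ⟨le_max_right _ _, max_le (min_le_right _ _) (by linarith)⟩

theorem abs_softThreshold_le {u s : C(K, ℝ)} (hs : ∀ x, 0 ≤ s x) (x : K) :
    |softThreshold u s x| ≤ |u x| := by
  have := hs x
  rw [softThreshold_apply]
  rcases min_cases (u x) (s x) with h | h <;>
    rcases max_cases (min (u x) (s x)) (-s x) with h' | h' <;>
    rcases abs_cases (u x) with h'' | h'' <;> rw [abs_le] <;> constructor <;> linarith

theorem softThreshold_eq_zero {u s : C(K, ℝ)} {x : K} (h : |u x| ≤ s x) :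
    softThreshold u s x = 0 := by
  rw [abs_le] at h
  rw [softThreshold_apply, min_eq_left h.2, max_eq_left h.1, sub_self]

variable [CompactSpace K]

theorem sum_abs_apply_le (ν : StrongDual ℝ C(K, ℝ)) {ι : Type*} {F : Finset ι}
    {w : ι → C(K, ℝ)} (h : ∀ x, ∑ n ∈ F, |w n x| ≤ 1) : ∑ n ∈ F, |ν (w n)| ≤ ‖ν‖ := by
  have h1 : ∀ n, |ν (w n)| = ν ((SignType.sign (ν (w n)) : ℝ) • w n) := fun n => by
    rw [map_smul, smul_eq_mul, sign_mul_self]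
  simp only [h1]
  rw [← map_sum]
  refine (le_norm_of_abs_le zero_le_one (fun x => ?_) ν).trans_eq (mul_one _)
  rw [ContinuousMap.sum_apply]
  refine (Finset.abs_sum_le_sum_abs _ _).trans (le_trans (Finset.sum_le_sum fun n _ => ?_) (h x))
  rw [ContinuousMap.smul_apply, smul_eq_mul, abs_mul]
  refine mul_le_of_le_one_left (abs_nonneg _) ?_
  rcases SignType.sign (ν (w n)) with _ | _ | _ <;> simp

theorem sum_abs_le_one_of_disjoint {ι : Type*} {F : Finset ι} {a : ι → ℝ} (h1 : ∀ n, |a n| ≤ 1)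
    (h : ∀ n ∈ F, ∀ m ∈ F, a n ≠ 0 → a m ≠ 0 → n = m) : ∑ n ∈ F, |a n| ≤ 1 := by
  by_cases hz : ∃ n ∈ F, a n ≠ 0
  · obtain ⟨n, hn, han⟩ := hz
    rw [Finset.sum_eq_single_of_mem n hn fun m hm hmn => by
      by_contra h0
      exact hmn (h m hm n hn (fun h' => h0 (by simp [h'])) han)]
    exact h1 n
  · push Not at hz
    rw [Finset.sum_eq_zero fun n hn => by simp [hz n hn]]
    exact zero_le_one

/-- Truncations of a sequence of functions that are disjoint up to a given index. -/
theorem exists_disjoint_truncation {u : ℕ → C(K, ℝ)} (hu : ∀ n x, |u n x| ≤ 1) {t : ℝ}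
    (ht : 0 < t) (N : ℕ) :
    ∃ w : ℕ → C(K, ℝ), (∀ n x, |w n x| ≤ 1) ∧
      (∀ (F : Finset ℕ), (∀ n ∈ F, n ≤ N) → ∀ y : StrongDual ℝ C(K, ℝ),
        ∑ n ∈ F, |y (w n)| ≤ ‖y‖) ∧
      ∀ n x, |(u n - w n) x| ≤
        (ContinuousMap.const K t + t⁻¹ • ∑ j ∈ Finset.range N, |u (n + 1 + j)|) x := by
  -- A continuous substitute for removing the later sets in L¹. If `w m x ≠ 0` for some `n < m ≤ N`,
  -- then `|u m x| > t`, so `s n x > 1` and `w n x = 0`. The sum is finite to keep `s n` continuous.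
  let s : ℕ → C(K, ℝ) := fun n =>
    ContinuousMap.const K t + t⁻¹ • ∑ j ∈ Finset.range N, |u (n + 1 + j)|
  have hs : ∀ n x, s n x = t + t⁻¹ * ∑ j ∈ Finset.range N, |u (n + 1 + j) x| := fun n x => by
    simp [s]
  have hst : ∀ n x, t ≤ s n x := fun n x => by
    rw [hs]
    have : 0 ≤ t⁻¹ * ∑ j ∈ Finset.range N, |u (n + 1 + j) x| := by positivity
    linarith
  have hs0 : ∀ n x, 0 ≤ s n x := fun n x => ht.le.trans (hst n x)
  have hw1 : ∀ n x, |softThreshold (u n) (s n) x| ≤ 1 := fun n x =>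
    (abs_softThreshold_le (hs0 n) x).trans (hu n x)
  have hdisj : ∀ n m x, n < m → m ≤ N → softThreshold (u n) (s n) x ≠ 0 →
      softThreshold (u m) (s m) x = 0 := by
    intro n m x hnm hmN hn
    refine softThreshold_eq_zero ?_
    by_contra! h
    have h1 : t < |u m x| := (hst m x).trans_lt h
    refine hn (softThreshold_eq_zero ((hu n x).trans ?_))
    rw [hs]
    have h2 : |u m x| ≤ ∑ j ∈ Finset.range N, |u (n + 1 + j) x| := by
      have := Finset.single_le_sum (f := fun j => |u (n + 1 + j) x|) (fun _ _ => abs_nonneg _)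
        (Finset.mem_range.2 (show m - (n + 1) < N by omega))
      simpa only [Nat.add_sub_cancel' (show n + 1 ≤ m from hnm)] using this
    have h3 : 1 ≤ t⁻¹ * ∑ j ∈ Finset.range N, |u (n + 1 + j) x| := by
      rw [← inv_mul_cancel₀ ht.ne']
      exact mul_le_mul_of_nonneg_left (h1.le.trans h2) (inv_nonneg.2 ht.le)
    linarith
  refine ⟨fun n => softThreshold (u n) (s n), hw1, fun F hF y => ?_, fun n x =>
    abs_sub_softThreshold_le (hs0 n) x⟩
  refine sum_abs_apply_le y fun x => sum_abs_le_one_of_disjoint (fun n => hw1 n x) ?_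
  intro n hn k hk hn0 hk0
  rcases lt_trichotomy n k with h | h | h
  · exact absurd (hdisj n k x h (hF k hk) hn0) hk0
  · exact h
  · exact absurd (hdisj k n x h (hF n hn) hk0) hn0

variable [MeasurableSpace K] [BorelSpace K]

theorem integrable_continuousMap (m : Measure K) [IsFiniteMeasure m] (u : C(K, ℝ)) :
    Integrable u m :=
  u.continuous.integrable_of_hasCompactSupport (HasCompactSupport.of_compactSpace _)

/-- Given functionals `ν n` dominated by measures `m n`, and functions `u n` that are small for
the preceding measures with `ν n (u n)` bounded below, there is a weakly unconditionally Cauchy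
series of functionals on `C(K)*` that is bounded below along the `ν n`. -/
theorem exists_wuc_of_almost_disjoint {ν : ℕ → StrongDual ℝ C(K, ℝ)} {m : ℕ → Measure K}
    [∀ n, IsFiniteMeasure (m n)]
    (hν : ∀ n (w u : C(K, ℝ)), (∀ x, |w x| ≤ u x) → ν n w ≤ ∫ x, u x ∂(m n))
    {M : ℝ} (hM : ∀ n, (m n).real univ ≤ M) {u : ℕ → C(K, ℝ)} (hu : ∀ n x, |u n x| ≤ 1)
    {t η ε : ℝ} (ht : 0 < t) (hη : 0 ≤ η)
    (hsmall : ∀ k j, ∫ x, |u (k + 1 + j) x| ∂(m k) ≤ η * (1 / 2) ^ j)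
    (hε : t * M + t⁻¹ * (2 * η) ≤ ε / 2) (hνu : ∀ n, ε ≤ ν n (u n)) :
    ∃ q : ℕ → StrongDual ℝ (StrongDual ℝ C(K, ℝ)),
      (∀ (F : Finset ℕ) (y : StrongDual ℝ C(K, ℝ)), ∑ n ∈ F, |q n y| ≤ 1 * ‖y‖) ∧
      ∀ n, ε / 2 ≤ q n (ν n) := by
  choose w hw1 hwsum hws using fun N => exists_disjoint_truncation hu ht N
  have hlow : ∀ n N, ε / 2 ≤ ν n (w N n) := by
    intro n N
    have h1 := hν n _ _ (hws N n)
    have h2 : ∫ x, (ContinuousMap.const K t +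
        t⁻¹ • ∑ j ∈ Finset.range N, |u (n + 1 + j)| : C(K, ℝ)) x ∂(m n) ≤
        t * M + t⁻¹ * (2 * η) := by
      have hi : ∀ j ∈ Finset.range N, Integrable (fun x => |u (n + 1 + j) x|) (m n) :=
        fun j _ => (integrable_continuousMap (m n) (u (n + 1 + j))).abs
      have heq : ∀ x, (ContinuousMap.const K t +
          t⁻¹ • ∑ j ∈ Finset.range N, |u (n + 1 + j)| : C(K, ℝ)) x =
          t + t⁻¹ * ∑ j ∈ Finset.range N, |u (n + 1 + j) x| := fun x => by simp
      simp only [heq]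
      rw [integral_add (integrable_const _) ((integrable_finsetSum _ hi).const_mul _),
        integral_const, integral_const_mul, integral_finsetSum _ hi, smul_eq_mul, mul_comm _ t]
      refine add_le_add (mul_le_mul_of_nonneg_left (hM n) ht.le)
        (mul_le_mul_of_nonneg_left ?_ (inv_nonneg.2 ht.le))
      refine (Finset.sum_le_sum fun j _ => hsmall n j).trans ?_
      have hgeo : ∑' j : ℕ, η * (1 / 2) ^ j = 2 * η := by
        rw [tsum_mul_left, tsum_geometric_two, mul_comm]
      rw [← hgeo]
      exact (summable_geometric_two.mul_left η).sum_le_tsum _ fun j _ => by positivity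
    rw [map_sub] at h1
    linarith [hνu n]
  -- Disjointness holds only up to `N`, so `N` is sent to infinity, and the functionals `q n` are
  -- limits of the `w N n` in the bidual of `C(K)`.
  obtain ⟨V, hV⟩ : ∃ V : Ultrafilter ℕ, (V : Filter ℕ) ≤ atTop :=
    ⟨hyperfilter ℕ, Nat.hyperfilter_le_atTop⟩
  have hlim : ∀ n, ∃ Q : StrongDual ℝ (StrongDual ℝ C(K, ℝ)),
      ∀ y, Tendsto (fun N => y (w N n)) V (𝓝 (Q y)) := fun n =>
    exists_bidual_limit V (x := fun N => w N n)
      (Eventually.of_forall fun N => (ContinuousMap.norm_le _ zero_le_one).2 (hw1 N n))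
  choose q hq using hlim
  refine ⟨q, fun F y => ?_, fun n => ge_of_tendsto' (hq n (ν n)) (hlow n)⟩
  rw [one_mul]
  refine le_of_tendsto (tendsto_finsetSum F fun n _ => (hq n y).abs) ?_
  filter_upwards [(eventually_ge_atTop (F.sup id)).filter_mono hV] with N hN
  exact hwsum N F (fun n hn => (Finset.le_sup (f := id) hn).trans hN) y

variable [T2Space K]

/-- Relatively weakly compact subsets of `C(K)*` are almost dominated by a finite measure. -/
theorem IsRelativelyWeaklyCompact.exists_abs_apply_le {S : Set (StrongDual ℝ C(K, ℝ))}
    (hS : IsRelativelyWeaklyCompact S) {ε : ℝ} (hε : 0 < ε) :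
    ∃ g : Measure K, IsFiniteMeasure g ∧
      ∀ ν ∈ S, ∀ u : C(K, ℝ), |ν u| ≤ ∫ x, |u x| ∂g + ε * ‖u‖ := by
  by_contra! hne
  have hne' : ∀ g : {g : Measure K // IsFiniteMeasure g}, ∃ ν ∈ S, ∃ u : C(K, ℝ),
      (∀ x, |u x| ≤ 1) ∧ ε + ∫ x, |u x| ∂g.1 ≤ ν u := by
    intro g
    obtain ⟨ν, hν, u, hu⟩ := hne g.1 g.2
    have hu0 : 0 < ‖u‖ := by
      rw [norm_pos_iff]
      rintro rfl
      simp at hu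
    -- Rescaling puts `u` in the unit ball and makes `ν u` positive.
    let c : ℝ := SignType.sign (ν u) / ‖u‖
    have hc : |c| ≤ ‖u‖⁻¹ := by
      rw [abs_div, abs_norm, div_eq_mul_inv]
      refine mul_le_of_le_one_left (by positivity) ?_
      rcases SignType.sign (ν u) with _ | _ | _ <;> simp
    have hcu : ∀ x, |(c • u) x| ≤ ‖u‖⁻¹ * |u x| := fun x => by
      rw [ContinuousMap.smul_apply, smul_eq_mul, abs_mul]
      exact mul_le_mul_of_nonneg_right hc (abs_nonneg _)
    refine ⟨ν, hν, c • u, fun x => (hcu x).trans ?_, ?_⟩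
    · rw [inv_mul_le_iff₀ hu0, mul_one]
      exact u.norm_coe_le_norm x
    · have := g.2
      have h1 : ∫ x, |(c • u) x| ∂g.1 ≤ ‖u‖⁻¹ * ∫ x, |u x| ∂g.1 := by
        rw [← integral_const_mul]
        exact integral_mono (integrable_continuousMap g.1 _).abs
          ((integrable_continuousMap g.1 u).abs.const_mul _) hcu
      have h2 : ν (c • u) = ‖u‖⁻¹ * |ν u| := by
        rw [map_smul, smul_eq_mul, ← sign_mul_self (ν u)]
        simp only [c]
        ring
      have h3 := mul_lt_mul_of_pos_left hu (inv_pos.2 hu0)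
      have h4 : ‖u‖⁻¹ * (∫ x, |u x| ∂g.1 + ε * ‖u‖) = ‖u‖⁻¹ * ∫ x, |u x| ∂g.1 + ε := by
        field_simp
      linarith
  obtain ⟨M₀, hM₀⟩ := hS.exists_norm_le
  obtain ⟨M, hM0, hM⟩ : ∃ M > 0, ∀ x ∈ S, ‖x‖ ≤ M :=
    ⟨max M₀ 1, by positivity, fun x hx => (hM₀ x hx).trans (le_max_left _ _)⟩
  choose pick hpickS pu hpu hpick using hne'
  choose dom hdomfin hdomM hdom using fun ν : StrongDual ℝ C(K, ℝ) => exists_dominating_measure ν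
  -- With `η = M / c`, both `t * M` and `t⁻¹ * (2 * η)` equal `ε / 4`, as
  -- `exists_wuc_of_almost_disjoint` requires.
  let t : ℝ := ε / (4 * M)
  have ht : 0 < t := by positivity
  let c : ℝ≥0 := ⟨8 * M / (t * ε), by positivity⟩
  have hcdef : (c : ℝ) = 8 * M / (t * ε) := rfl
  have hc : (0 : ℝ) < c := by
    rw [hcdef]
    positivity
  let G : ℕ → {g : Measure K // IsFiniteMeasure g} := fun n =>
    Nat.rec ⟨0, inferInstance⟩ (fun _ g => ⟨(2 : ℝ≥0) • g.1 + c • dom (pick g), by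
      have := g.2
      infer_instance⟩) n
  let ν : ℕ → StrongDual ℝ C(K, ℝ) := fun n => pick (G n)
  let u : ℕ → C(K, ℝ) := fun n => pu (G n)
  have hGfin : ∀ n, IsFiniteMeasure (G n).1 := fun n => (G n).2
  have hGs : ∀ n (v : C(K, ℝ)), ∫ x, |v x| ∂(G (n + 1)).1 =
      2 * ∫ x, |v x| ∂(G n).1 + c * ∫ x, |v x| ∂(dom (ν n)) := by
    intro n v
    have hi : ∀ (m : Measure K) [IsFiniteMeasure m], Integrable (fun x => |v x|) m :=
      fun m _ => (integrable_continuousMap m v).abs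
    change ∫ x, |v x| ∂((2 : ℝ≥0) • (G n).1 + c • dom (ν n)) = _
    rw [integral_add_measure (hi _) (hi _), integral_smul_nnreal_measure,
      integral_smul_nnreal_measure]
    rfl
  have hG : ∀ k j (v : C(K, ℝ)),
      2 ^ j * c * ∫ x, |v x| ∂(dom (ν k)) ≤ ∫ x, |v x| ∂(G (k + j + 1)).1 := by
    intro k j v
    have hnn : ∀ m : Measure K, 0 ≤ ∫ x, |v x| ∂m := fun m => integral_nonneg fun _ => abs_nonneg _
    induction j with
    | zero =>
      have := hnn (G k).1
      rw [add_zero, hGs, pow_zero, one_mul]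
      linarith
    | succ j ih =>
      have : 0 ≤ c * ∫ x, |v x| ∂(dom (ν (k + (j + 1)))) := mul_nonneg hc.le (hnn _)
      rw [hGs, pow_succ]
      rw [← add_assoc] at this ⊢
      linarith
  have hsmall : ∀ k j, ∫ x, |u (k + 1 + j) x| ∂(dom (ν k)) ≤ M / c * (1 / 2) ^ j := by
    intro k j
    rw [show k + 1 + j = k + j + 1 by ring]
    have h1 : 2 ^ j * c * ∫ x, |u (k + j + 1) x| ∂(dom (ν k)) ≤ M := by
      refine (hG k j _).trans ?_
      have h2 := hpick (G (k + j + 1))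
      have h3 := le_norm_of_abs_le zero_le_one (hpu (G (k + j + 1))) (ν (k + j + 1))
      have h4 := hM _ (hpickS (G (k + j + 1)))
      simp only [u, ν] at h3 ⊢
      linarith
    have h2 : (0 : ℝ) < 2 ^ j * c := by positivity
    rw [mul_comm, ← le_div_iff₀ h2] at h1
    refine h1.trans_eq ?_
    rw [one_div, inv_pow]
    field_simp
  obtain ⟨q, hq, hqν⟩ := exists_wuc_of_almost_disjoint (ν := ν) (m := fun n => dom (ν n))
    (fun n => hdom (ν n)) (fun n => (hdomM (ν n)).trans (hM _ (hpickS _))) (u := u)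
    (fun n => hpu (G n)) ht (by positivity) hsmall (ε := ε) (by
      rw [hcdef]
      simp only [t]
      field_simp
      norm_num) fun n => by
      have := hpick (G n)
      have h0 : 0 ≤ ∫ x, |pu (G n) x| ∂(G n).1 := integral_nonneg fun _ => abs_nonneg _
      simp only [u, ν]
      linarith
  exact hS.not_forall_le_apply (fun n => hpickS (G n)) zero_le_one hq (half_pos hε) hqν

/-- Relatively weakly compact subsets of `C(K)*` are almost dominated by a Hilbert seminorm. -/
theorem IsRelativelyWeaklyCompact.exists_abs_apply_le_norm {S : Set (StrongDual ℝ C(K, ℝ))}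
    (hS : IsRelativelyWeaklyCompact S) {ε : ℝ} (hε : 0 < ε) :
    ∃ (g : Measure K) (j : C(K, ℝ) →L[ℝ] Lp ℝ 2 g),
      ∀ ν ∈ S, ∀ u : C(K, ℝ), |ν u| ≤ ‖j u‖ + ε * ‖u‖ := by
  obtain ⟨g, hg, h⟩ := hS.exists_abs_apply_le hε
  let J : C(K, ℝ) →L[ℝ] Lp ℝ 2 g := ContinuousMap.toLp 2 g ℝ
  have hJ : ∀ u : C(K, ℝ), J u =ᵐ[g] u := fun u => ContinuousMap.coeFn_toLp g u
  -- Cauchy–Schwarz against the constant `1`; the factor `‖J 1‖` is absorbed into the map.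
  refine ⟨g, ‖J 1‖ • J, fun ν hν u => (h ν hν u).trans (add_le_add ?_ le_rfl)⟩
  have h1 : ∫ x, |u x| ∂g = inner ℝ (J 1) (J |u|) := by
    rw [L2.inner_def]
    refine integral_congr_ae ?_
    filter_upwards [hJ 1, hJ |u|] with x h1 h2
    simp [h1, h2]
  have h2 : ‖J |u|‖ ≤ ‖J u‖ := by
    refine Lp.norm_le_norm_of_ae_le ?_
    filter_upwards [hJ u, hJ |u|] with x h1 h2
    simp [h1, h2]
  rw [h1, smul_apply, norm_smul, norm_norm]
  exact (real_inner_le_norm _ _).trans (mul_le_mul_of_nonneg_left h2 (norm_nonneg _))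

end DualOfContinuousFunctions

/-! ### From sets to operators -/

section Operators

variable {E F : Type*} [NormedAddCommGroup E] [NormedSpace ℝ E] [NormedAddCommGroup F]
  [NormedSpace ℝ F]

/-- The image of the unit ball under `T^U` lies in the ultrapower of twice the image of the
unit ball under `T`. -/
theorem isWeaklyCompactOperator_ultrapowerMap {I : Type*} (U : Ultrafilter I) {T : E →L[ℝ] F}
    (h : IsRelativelyWeaklyCompact
      (ultrapowerSet U (((2 : ℝ) • ContinuousLinearMap.id ℝ F) '' (T '' Metric.closedBall 0 1)))) :
    IsWeaklyCompactOperator (ultrapowerMap U T) := by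
  refine h.mono ?_
  rintro _ ⟨ξ, hξ, rfl⟩
  -- The quotient norm is an infimum, and `exists_ultrapower_rep` needs a radius strictly above
  -- `‖ξ‖`; hence the `2`.
  obtain ⟨x, rfl, hx⟩ := exists_ultrapower_rep U ξ (r := 2)
    ((mem_closedBall_zero_iff.1 hξ).trans_lt one_lt_two)
  refine ⟨bddFamilyMap I T x, fun i => ⟨T ((2 : ℝ)⁻¹ • x i), mem_image_of_mem _ ?_, ?_⟩, rfl⟩
  · rw [mem_closedBall_zero_iff, norm_smul, norm_inv, Real.norm_ofNat,
      inv_mul_le_iff₀ zero_lt_two, mul_one]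
    exact hx i
  · simp [bddFamilyMap_apply]

theorem norm_le_of_abs_comp_le {T : E →L[ℝ] F} {u : E} {C : ℝ}
    (h : ∀ f : StrongDual ℝ F, ‖f‖ ≤ 1 → |f.comp T u| ≤ C) : ‖T u‖ ≤ C := by
  obtain ⟨f, hf, hfu⟩ := exists_dual_vector'' ℝ (T u)
  have := (le_abs_self _).trans (h f hf)
  rwa [ContinuousLinearMap.comp_apply, hfu] at this

end Operators

/-! ### Super weak compactness -/

section SuperWeaklyCompact

variable {I : Type*} (U : Ultrafilter I)

theorem isRelativelyWeaklyCompact_ultrapowerSet_L1 {Ω : Type*} [MeasurableSpace Ω]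
    {μ : Measure Ω} {S : Set (Lp ℝ 1 μ)} (hS : IsRelativelyWeaklyCompact S) :
    IsRelativelyWeaklyCompact (ultrapowerSet U S) :=
  isRelativelyWeaklyCompact_ultrapowerSet U fun _ hε =>
    ⟨Lp ℝ 2 μ, inferInstance, inferInstance, inferInstance, inferInstance,
      hS.exists_hilbert_approx_L1 hε⟩

variable {K : Type*} [TopologicalSpace K] [CompactSpace K] [T2Space K]

theorem isRelativelyWeaklyCompact_ultrapowerSet_dual {S : Set (StrongDual ℝ C(K, ℝ))}
    (hS : IsRelativelyWeaklyCompact S) : IsRelativelyWeaklyCompact (ultrapowerSet U S) := by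
  borelize K
  refine isRelativelyWeaklyCompact_ultrapowerSet U fun ε hε => ?_
  obtain ⟨g, j, hj⟩ := hS.exists_abs_apply_le_norm hε
  exact ⟨Lp ℝ 2 g, inferInstance, inferInstance, inferInstance, inferInstance,
    (ContinuousLinearMap.compL ℝ C(K, ℝ) (Lp ℝ 2 g) ℝ).flip j ∘L innerSL ℝ, 1,
    fun ν hν => exists_hilbert_split j hε.le (hj ν hν)⟩

/-- The dual of an ultrapower can be larger than the ultrapower of the dual, so the adjoint is used
only before passing to the ultrapower, to get the norm inequality for `T`. -/
theorem IsWeaklyCompactOperator.ultrapowerMap_continuousMap {F : Type*} [NormedAddCommGroup F]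
    [NormedSpace ℝ F] [CompleteSpace F] {T : C(K, ℝ) →L[ℝ] F} (hT : IsWeaklyCompactOperator T) :
    IsWeaklyCompactOperator (ultrapowerMap U T) := by
  borelize K
  refine isWeaklyCompactOperator_of_norm_le fun ε hε => ?_
  obtain ⟨g, j, hj⟩ := hT.isRelativelyWeaklyCompact_adjoint.exists_abs_apply_le_norm hε
  exact ⟨Ultrapower U (Lp ℝ 2 g), inferInstance, inferInstance, inferInstance, inferInstance,
    ultrapowerMap U j, norm_ultrapowerMap_le U fun u => norm_le_of_abs_comp_le fun f hf =>
      hj _ (mem_image_of_mem _ (mem_closedBall_zero_iff.2 hf)) u⟩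

end SuperWeaklyCompact

theorem proposition6p1
    {Ω : Type*} [MeasurableSpace Ω] (μ : Measure Ω)
    {K : Type*} [TopologicalSpace K] [CompactSpace K] [T2Space K]
    {X : Type*} [NormedAddCommGroup X] [NormedSpace ℝ X] [CompleteSpace X] :
    (∀ S : Set (Lp ℝ 1 μ), IsWeaklyCompact S → IsSuperWeaklyCompact.{w} S) ∧
    (∀ S : Set (StrongDual ℝ C(K, ℝ)), IsWeaklyCompact S → IsSuperWeaklyCompact.{w} S) ∧
    (∀ T : X →L[ℝ] Lp ℝ 1 μ,
      IsWeaklyCompactOperator T → IsSuperWeaklyCompactOperator.{w} T) ∧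
    (∀ T : C(K, ℝ) →L[ℝ] X,
      IsWeaklyCompactOperator T → IsSuperWeaklyCompactOperator.{w} T) :=
  ⟨fun _ hS => ⟨hS.isWeaklyClosed, fun _ U _ =>
      isRelativelyWeaklyCompact_ultrapowerSet_L1 U hS.isRelativelyWeaklyCompact⟩,
    fun _ hS => ⟨hS.isWeaklyClosed, fun _ U _ =>
      isRelativelyWeaklyCompact_ultrapowerSet_dual U hS.isRelativelyWeaklyCompact⟩,
    fun _ hT _ U => isWeaklyCompactOperator_ultrapowerMap U
      (isRelativelyWeaklyCompact_ultrapowerSet_L1 U (hT.image _)),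
    fun _ hT _ U => hT.ultrapowerMap_continuousMap U⟩
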